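/- Let $N\ge 2$. There are $N$ non-colluding databases, each storing the same two independent messages $W_1,W_2$, each uniformly distributed on $\{0,1\}^L$, and two users; user $k\in\{1,2\}$ demands $W_{\theta_k}$, where the demand vector $\theta=(\theta_1,\theta_2)\in\{1,2\}^2$ is independent of the messages and has a fixed, arbitrary distribution with full support. For $0\le M\le 2$, a scheme with uncoded cache placement consists of the following. Before the demands are known, each user $k$ stores a fixed set of at most $ML$ of the $2L$ message bits; $Z_k$ denotes its content. Queries $Q_1,\dots,Q_N$ (with finite alphabets) are then generated at random by a law that may depend on $\theta$ and on $Z_1,Z_2$, but, beyond what its own cache holds, the queries reveal nothing about the messages to either user: $I(Q_{1:N};W_1,W_2\mid\theta,Z_k)=0$ for $k=1,2$. Database $n$ broadcasts to both users an answer $A_n$ (with finite alphabet) that is a deterministic function of $Q_n$ and $(W_1,W_2)$. It is required that * (decodability) $H(W_{\theta_k}\mid \theta, Q_{1:N},A_{1:N},Z_k)=0$ for $k=1,2$; * (privacy) $I(\theta;Q_n,A_n,W_1,W_2,Z_1,Z_2)=0$ for every $n\in\{1,\dots,N\}$. The load of the scheme is $R=\frac1L\sum_{n=1}^N H(A_n)$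 (entropy in bits). Let $R^\star_{\mathrm{uncoded}}(M)$ be the infimum of the loads of all such schemes, over all $L\ge1$. Then, for all $0\le M\le 2$, $$R^\star_{\mathrm{uncoded}}(M)=\begin{cases}2-\frac32 M, & 0\le M\le \frac{2(N-1)}{2N-1},\\[2pt] \frac{(N+1)(2-M)}{2N}, & \frac{2(N-1)}{2N-1}\le M\le 2,\end{cases}$$ and the infimum is attained, i.e. is a minimum, whenever $M$ is rational. -/

import Mathlib

noncomputable section

namespace MuPIR

/-! Shannon entropy, in bits, of random variables with finitely many values, given as functions on
a sample space `Ω` that carries the probability law `P`. -/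

/-- The entropy `H(X)` in bits. -/
def entropy {Ω α : Type} [Fintype α] (P : PMF Ω) (X : Ω → α) : ℝ :=
  ∑ x : α, Real.negMulLog ((P.map X) x).toReal / Real.log 2

/-- The conditional entropy `H(X | Y) = H(X, Y) - H(Y)`. -/
def condEntropy {Ω α β : Type} [Fintype α] [Fintype β] (P : PMF Ω) (X : Ω → α) (Y : Ω → β) : ℝ :=
  entropy P (fun ω => (X ω, Y ω)) - entropy P Y

/-- The mutual information `I(X; Y) = H(X) - H(X | Y)`. -/
def mutualInfo {Ω α β : Type} [Fintype α] [Fintype β] (P : PMF Ω) (X : Ω → α) (Y : Ω → β) : ℝ :=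
  entropy P X - condEntropy P X Y

/-- The conditional mutual information `I(X; Y | Z) = H(X | Z) - H(X | Y, Z)`. -/
def condMutualInfo {Ω α β γ : Type} [Fintype α] [Fintype β] [Fintype γ]
    (P : PMF Ω) (X : Ω → α) (Y : Ω → β) (Z : Ω → γ) : ℝ :=
  condEntropy P X Z - condEntropy P X (fun ω => (Y ω, Z ω))

/-- Demand vectors `θ` of `U` users: user `k` wants message `θ k` out of `K`. -/
abbrev Demand (K U : ℕ) : Type := Fin U → Fin K

/-- The library: `K` messages of `L` bits each. -/
abbrev Messages (K L : ℕ) : Type := Fin K → Fin L → Bool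

/-- A scheme with uncoded cache placement for `K` messages of `L` bits, `U` users, `N` databases.
`cache k` is the set of (positions of) library bits that user `k` stores, chosen before the demands
are known; bit `(i, j)` is the `j`-th bit of message `i`. The `N` queries are drawn jointly, by a
law that may depend on the demands and on the contents of the caches (and, being part of the
scheme, on the placement). The answer of database `n` is a deterministic function of the query it
receives and the messages (and hence of the caches, which are functions of the messages). -/
structure UncodedScheme (K U N L : ℕ) where
  cache : Fin U → Finset (Fin K × Fin L)
  Query : Fin N → Type
  Answer : Fin N → Type
  [fintypeQuery : ∀ n, Fintype (Query n)]
  [fintypeAnswer : ∀ n, Fintype (Answer n)]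
  queryLaw : Demand K U → ((k : Fin U) → {b // b ∈ cache k} → Bool) → PMF ((n : Fin N) → Query n)
  answer : (n : Fin N) → Query n → Messages K L → Answer n

namespace UncodedScheme

attribute [instance] UncodedScheme.fintypeQuery UncodedScheme.fintypeAnswer

variable {K U N L : ℕ} (S : UncodedScheme K U N L)

/-- Content of the caches when the library is `W`. -/
def cacheContent (W : Messages K L) (k : Fin U) : {b // b ∈ S.cache k} → Bool :=
  fun b => W b.1.1 b.1.2

/-- Outcomes of the experiment: demands, messages, queries. -/
abbrev Outcome : Type := Demand K U × Messages K L × ((n : Fin N) → S.Query n)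

/-- Joint law of demands, messages and queries, when the demands have law `p`: the messages are
independent, uniform, and independent of the demands; the queries are then drawn by `queryLaw`. -/
def jointLaw (p : PMF (Demand K U)) : PMF S.Outcome :=
  p.bind fun θ => (PMF.uniformOfFintype (Messages K L)).bind fun W =>
    (S.queryLaw θ (S.cacheContent W)).map fun q => (θ, W, q)

/-- The demand vector `θ`. -/
def demandRV (ω : S.Outcome) : Demand K U := ω.1

/-- All messages `W_1, …, W_K`. -/
def messagesRV (ω : S.Outcome) : Messages K L := ω.2.1

/-- All queries `Q_1, …, Q_N`. -/
def queriesRV (ω : S.Outcome) : (n : Fin N) → S.Query n := ω.2.2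

/-- The query `Q_n`. -/
def queryRV (n : Fin N) (ω : S.Outcome) : S.Query n := ω.2.2 n

/-- The answer `A_n`. -/
def answerRV (n : Fin N) (ω : S.Outcome) : S.Answer n := S.answer n (ω.2.2 n) ω.2.1

/-- All answers `A_1, …, A_N`. -/
def answersRV (ω : S.Outcome) : (n : Fin N) → S.Answer n := fun n => S.answerRV n ω

/-- The cached content `Z_k` of user `k`. -/
def cacheRV (k : Fin U) (ω : S.Outcome) : {b // b ∈ S.cache k} → Bool := S.cacheContent ω.2.1 k

/-- All cached contents `Z_1, …, Z_U`. -/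
def cachesRV (ω : S.Outcome) : (k : Fin U) → {b // b ∈ S.cache k} → Bool := S.cacheContent ω.2.1

/-- The message `W_{θ_k}` that user `k` wants. -/
def wantedRV (k : Fin U) (ω : S.Outcome) : Fin L → Bool := ω.2.1 (ω.1 k)

/-- Every user recovers the wanted message without error from all queries, all answers and its own
cache. Conditioning on `θ` expresses that this is required for each value of the demand vector. -/
def Decodable (p : PMF (Demand K U)) : Prop :=
  ∀ k : Fin U, condEntropy (S.jointLaw p) (S.wantedRV k)
    (fun ω => (S.demandRV ω, S.queriesRV ω, S.answersRV ω, S.cacheRV k ω)) = 0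

/-- No single database learns anything about the demands, even knowing all messages and caches. -/
def Private (p : PMF (Demand K U)) : Prop :=
  ∀ n : Fin N, mutualInfo (S.jointLaw p) S.demandRV
    (fun ω => (S.queryRV n ω, S.answerRV n ω, S.messagesRV ω, S.cachesRV ω)) = 0

/-- The queries (which every user knows) do not carry cached content from one user to another:
beyond what its own cache holds, no user learns anything about the messages from the queries. -/
def NoSideChannel (p : PMF (Demand K U)) : Prop :=
  ∀ k : Fin U, condMutualInfo (S.jointLaw p) S.queriesRV S.messagesRV
    (fun ω => (S.demandRV ω, S.cacheRV k ω)) = 0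

/-- The load `(H(A_1) + ⋯ + H(A_N)) / L`. -/
def load (p : PMF (Demand K U)) : ℝ :=
  (∑ n : Fin N, entropy (S.jointLaw p) (S.answerRV n)) / L

end UncodedScheme

/-- The loads `R` for which the memory-load pair `(M, R)` is achieved, for some message length, by
an uncoded scheme in which every user caches at most `M L` bits. -/
def achievableUncodedLoads (K U N : ℕ) (p : PMF (Demand K U)) (M : ℝ) : Set ℝ :=
  {R | ∃ L : ℕ, 0 < L ∧ ∃ S : UncodedScheme K U N L,
    (∀ k, ((S.cache k).card : ℝ) ≤ M * L) ∧
    S.NoSideChannel p ∧ S.Decodable p ∧ S.Private p ∧ S.load p = R}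

/-- The optimal load under uncoded cache placement, the infimum of the achievable loads. -/
def optimalUncodedLoad (K U N : ℕ) (p : PMF (Demand K U)) (M : ℝ) : ℝ :=
  sInf (achievableUncodedLoads K U N p M)

end MuPIR

end

/-! The optimum is the maximum of two affine functions of `M`. Each is a converse bound, and one
family of schemes meets both. Converse: fix a demand `θ`, with user `k` wanting message `i`, and let
`j` be the other message. The queries tell user `k` nothing about the messages beyond its cache, so
decoding gives H(A) ≥ H(W_i | Z_k) + H(A | Q, W_i, Z_k) (`entropy_wanted_add_le`). The last term is
bounded below in two ways. If the other user wants `j`, adding its cache makes the whole library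
decodable (`entropy_le_of_second_user`). Alternatively, compare with a demand in which user `k`
wants `j`: there the answers jointly reveal all of H(W_j | W_i, Z_k), and by privacy each single
answer behaves the same under both demands, so at least 1/N of it is already revealed under `θ`
(`entropy_le_of_private`). With uncoded caches these entropies are counts of cached bits. Averaging
the two bounds over the roles of users and messages gives the two lines. Achievability: let `m = N -
1` and cut each message into one uncached block and `m` blocks owned by each user. Database 0 sends,
for each message, a random combination of its blocks in which the uncached block has coefficient 1.
Each other database sends the sum of these two combinations, with two coefficients flipped;
cancelling the mask leaves a coded multicast useful to both users. Then the first answer releases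
the uncached block of the wanted message. Each query alone is uniform, whence privacy. This reaches
the corner `M = 2m/(2m+1)`, load `(m+2)/(2m+1)`. Extra bits cached by nobody or by both users reach
every other rational `M`; irrational `M` follows by approximation from below. -/

open Finset

namespace MuPIR

noncomputable section

/-! ### Entropy inequalities, and mixtures of laws. -/

section Entropy

variable {Ω Ω' Θ α β γ δ : Type}

/-- The probability of the event `X = x`, as a real number. -/
def prob (P : PMF Ω) (X : Ω → α) (x : α) : ℝ := ((P.map X) x).toReal

lemma prob_nonneg (P : PMF Ω) (X : Ω → α) (x : α) : 0 ≤ prob P X x := ENNReal.toReal_nonneg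

lemma sum_toReal_eq_one [Fintype α] (p : PMF α) : ∑ x, (p x).toReal = 1 := by
  rw [← ENNReal.toReal_sum fun x _ => p.apply_ne_top x, ← tsum_fintype (L := .unconditional _),
    p.tsum_coe, ENNReal.toReal_one]

lemma sum_prob [Fintype α] (P : PMF Ω) (X : Ω → α) : ∑ x, prob P X x = 1 :=
  sum_toReal_eq_one _

lemma prob_comp [Fintype α] [DecidableEq β] (P : PMF Ω) (X : Ω → α) (f : α → β) (y : β) :
    prob P (fun ω => f (X ω)) y = ∑ x, if y = f x then prob P X x else 0 := by
  have : P.map (fun ω => f (X ω)) = (P.map X).map f := by rw [PMF.map_comp]; rfl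
  rw [prob, this, PMF.map_apply, tsum_fintype, ENNReal.toReal_sum]
  · refine Finset.sum_congr rfl fun x _ => ?_
    split_ifs with h
    · simp [prob]
    · simp
  · intro x _
    split_ifs
    · exact PMF.apply_ne_top _ _
    · simp

lemma prob_fst [Fintype α] [Fintype β] (P : PMF Ω) (X : Ω → α) (Y : Ω → β) (x : α) :
    prob P X x = ∑ y, prob P (fun ω => (X ω, Y ω)) (x, y) := by
  classical
  rw [prob_comp P (fun ω => (X ω, Y ω)) Prod.fst x, Fintype.sum_prod_type, Finset.sum_eq_single x]
  · simp
  · intro x' _ hx'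
    simp [Ne.symm hx']
  · simp

lemma prob_bind [Fintype Θ] (p : PMF Θ) (κ : Θ → PMF Ω) (X : Ω → α) (x : α) :
    prob (p.bind κ) X x = ∑ t, (p t).toReal * prob (κ t) X x := by
  rw [prob, PMF.map_bind, PMF.bind_apply, tsum_fintype, ENNReal.toReal_sum]
  · simp [prob]
  · exact fun t _ => ENNReal.mul_ne_top (p.apply_ne_top t) (PMF.apply_ne_top _ _)

lemma map_congr_support (P : PMF Ω) {X Y : Ω → α} (h : ∀ ω ∈ P.support, X ω = Y ω) :
    P.map X = P.map Y := by
  classical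
  ext x
  rw [PMF.map_apply, PMF.map_apply]
  refine tsum_congr fun ω => ?_
  by_cases hω : P ω = 0
  · simp [hω]
  · rw [h ω ((PMF.mem_support_iff _ _).2 hω)]

lemma entropy_eq_sum_div [Fintype α] (P : PMF Ω) (X : Ω → α) :
    entropy P X = (∑ x, Real.negMulLog (prob P X x)) / Real.log 2 := by
  rw [entropy, Finset.sum_div]; rfl

lemma entropy_congr_prob [Fintype α] {P : PMF Ω} {P' : PMF Ω'} {X : Ω → α} {Y : Ω' → α}
    (h : ∀ x, prob P X x = prob P' Y x) : entropy P X = entropy P' Y := by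
  simp only [entropy_eq_sum_div, h]

lemma entropy_congr_support [Fintype α] (P : PMF Ω) {X Y : Ω → α}
    (h : ∀ ω ∈ P.support, X ω = Y ω) : entropy P X = entropy P Y := by
  rw [entropy, entropy, map_congr_support P h]

lemma entropy_congr_comp [Fintype α] [Fintype β] {P : PMF Ω} {P' : PMF Ω'} {X : Ω → α}
    {Y : Ω' → α} (h : ∀ x, prob P X x = prob P' Y x) (f : α → β) :
    entropy P (fun ω => f (X ω)) = entropy P' (fun ω => f (Y ω)) := by
  classical
  refine entropy_congr_prob fun z => ?_
  rw [prob_comp P X f, prob_comp P' Y f]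
  simp only [h]

lemma entropy_comp_injective [Fintype α] [Fintype β] (P : PMF Ω) (X : Ω → α) {f : α → β}
    (hf : Function.Injective f) : entropy P (fun ω => f (X ω)) = entropy P X := by
  classical
  rw [entropy_eq_sum_div, entropy_eq_sum_div]
  congr 1
  rw [← Finset.sum_subset (Finset.subset_univ (univ.map ⟨f, hf⟩))]
  · rw [Finset.sum_map]
    refine Finset.sum_congr rfl fun x _ => ?_
    rw [prob_comp P X f, Finset.sum_eq_single x]
    · simp
    · intro y _ hy
      simp [hf.eq_iff, Ne.symm hy]
    · simp
  · intro y _ hy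
    rw [prob_comp P X f, Finset.sum_eq_zero, Real.negMulLog_zero]
    intro x _
    rw [if_neg]
    rintro rfl
    simp at hy

lemma negMulLog_add_le {x y : ℝ} (hx : 0 ≤ x) (hy : 0 ≤ y) :
    Real.negMulLog (x + y) ≤ Real.negMulLog x + Real.negMulLog y := by
  rcases hx.eq_or_lt with rfl | hx
  · simp
  rcases hy.eq_or_lt with rfl | hy
  · simp
  have h1 := Real.log_le_log hx (by linarith : x ≤ x + y)
  have h2 := Real.log_le_log hy (by linarith : y ≤ x + y)
  simp only [Real.negMulLog]
  nlinarith

lemma negMulLog_sum_le (s : Finset α) {f : α → ℝ} (hf : ∀ i, 0 ≤ f i) :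
    Real.negMulLog (∑ i ∈ s, f i) ≤ ∑ i ∈ s, Real.negMulLog (f i) := by
  classical
  induction s using Finset.induction_on with
  | empty => simp
  | insert a s ha ih =>
    rw [Finset.sum_insert ha, Finset.sum_insert ha]
    exact (negMulLog_add_le (hf a) (Finset.sum_nonneg fun i _ => hf i)).trans (by linarith)

lemma entropy_le_entropy_prod [Fintype α] [Fintype β] (P : PMF Ω) (X : Ω → α) (Y : Ω → β) :
    entropy P X ≤ entropy P (fun ω => (X ω, Y ω)) := by
  rw [entropy_eq_sum_div, entropy_eq_sum_div, Fintype.sum_prod_type]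
  refine div_le_div_of_nonneg_right (Finset.sum_le_sum fun x _ => ?_) (Real.log_nonneg one_le_two)
  rw [prob_fst P X Y x]
  exact negMulLog_sum_le _ fun y => prob_nonneg _ _ _

/-- Almost surely, `Y` determines `X`. -/
def Determines (P : PMF Ω) (Y : Ω → β) (X : Ω → α) : Prop :=
  ∀ ω ∈ P.support, ∀ ω' ∈ P.support, Y ω = Y ω' → X ω = X ω'

lemma Determines.exists_comp_eq {P : PMF Ω} {X : Ω → α} {Y : Ω → β} (h : Determines P Y X) :
    ∃ f : β → α, ∀ ω ∈ P.support, X ω = f (Y ω) := by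
  have key : ∀ y, ∃ x, ∀ ω ∈ P.support, Y ω = y → X ω = x := by
    intro y
    by_cases hy : ∃ ω ∈ P.support, Y ω = y
    · obtain ⟨ω', hω', rfl⟩ := hy
      exact ⟨X ω', fun ω hω he => h ω hω ω' hω' he⟩
    -- Values of `Y` of probability zero may be sent anywhere; the support provides some element of
    -- `α`.
    · obtain ⟨ω₀, -⟩ := P.support_nonempty
      exact ⟨X ω₀, fun ω hω he => absurd ⟨ω, hω, he⟩ hy⟩
  choose f hf using key
  exact ⟨f, fun ω hω => hf _ ω hω rfl⟩

lemma entropy_comp_prod_self [Fintype α] [Fintype β] (P : PMF Ω) (Y : Ω → β) (f : β → α) :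
    entropy P (fun ω => (f (Y ω), Y ω)) = entropy P Y :=
  entropy_comp_injective P Y (f := fun y => (f y, y)) fun _ _ hyy => (Prod.ext_iff.1 hyy).2

lemma Determines.entropy_prod_eq [Fintype α] [Fintype β] {P : PMF Ω} {X : Ω → α} {Y : Ω → β}
    (h : Determines P Y X) : entropy P (fun ω => (X ω, Y ω)) = entropy P Y :=
  h.exists_comp_eq.elim fun f hf =>
    (entropy_congr_support P fun ω hω => by rw [hf ω hω]).trans (entropy_comp_prod_self P Y f)

lemma Determines.entropy_le [Fintype α] [Fintype β] {P : PMF Ω} {X : Ω → α} {Y : Ω → β}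
    (h : Determines P Y X) : entropy P X ≤ entropy P Y :=
  (entropy_le_entropy_prod P X Y).trans h.entropy_prod_eq.le

lemma Determines.entropy_eq [Fintype α] [Fintype β] {P : PMF Ω} {X : Ω → α} {Y : Ω → β}
    (h : Determines P Y X) (h' : Determines P X Y) : entropy P X = entropy P Y :=
  h.entropy_le.antisymm h'.entropy_le

/-- Gibbs' inequality. -/
lemma sum_mul_log_sub_log_nonneg [Fintype α] {p q : α → ℝ} (hp : ∀ i, 0 ≤ p i)
    (hq : ∀ i, 0 ≤ q i) (hpq : ∀ i, q i = 0 → p i = 0) (hsum : ∑ i, q i ≤ ∑ i, p i) :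
    0 ≤ ∑ i, p i * (Real.log (p i) - Real.log (q i)) := by
  have key : ∀ i, p i - q i ≤ p i * (Real.log (p i) - Real.log (q i)) := by
    intro i
    rcases (hp i).eq_or_lt with h | h
    · rw [← h]; simpa using hq i
    · have hq' : 0 < q i := (hq i).lt_of_ne fun h0 => h.ne' (hpq i h0.symm)
      have := Real.log_le_sub_one_of_pos (div_pos hq' h)
      rw [Real.log_div hq'.ne' h.ne'] at this
      have h2 := mul_le_mul_of_nonneg_left this h.le
      have h3 : p i * (q i / p i - 1) = q i - p i := by field_simp
      linarith
  calc (0 : ℝ) ≤ ∑ i, p i - ∑ i, q i := by linarith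
    _ = ∑ i, (p i - q i) := by rw [Finset.sum_sub_distrib]
    _ ≤ _ := Finset.sum_le_sum fun i _ => key i

/-- Expressing the entropy of a marginal as an expectation under the joint law lets several marginal
entropies be compared in a single sum. -/
lemma sum_negMulLog_prob_comp [Fintype α] [Fintype β] (P : PMF Ω) (X : Ω → α) (f : α → β) :
    ∑ y, Real.negMulLog (prob P (fun ω => f (X ω)) y) =
      -∑ x, prob P X x * Real.log (prob P (fun ω => f (X ω)) (f x)) := by
  classical
  have : ∀ y, Real.negMulLog (prob P (fun ω => f (X ω)) y) = -∑ x, if y = f x then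
      prob P X x * Real.log (prob P (fun ω => f (X ω)) (f x)) else 0 := by
    intro y
    rw [Real.negMulLog, neg_mul]
    nth_rw 1 [prob_comp P X f y]
    rw [Finset.sum_mul]
    congr 1
    refine Finset.sum_congr rfl fun x _ => ?_
    split_ifs with h
    · rw [h]
    · simp
  simp only [this]
  rw [Finset.sum_neg_distrib, Finset.sum_comm]
  simp

lemma prob_le_prob_comp [Fintype α] (P : PMF Ω) (X : Ω → α) (f : α → β) (x : α) :
    prob P X x ≤ prob P (fun ω => f (X ω)) (f x) := by
  classical
  rw [prob_comp P X f]
  refine le_trans (by simp) (Finset.single_le_sum (f := fun x' => if f x = f x' then prob P X x' else 0)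
    (fun x' _ => ?_) (Finset.mem_univ x))
  split_ifs
  · exact prob_nonneg _ _ _
  · rfl

/-- Gibbs' inequality for the joint law against p(x,z) p(y,z) / p(z), the law that makes X and Y
conditionally independent given Z. -/
lemma entropy_triple_add_entropy_le [Fintype α] [Fintype β] [Fintype γ] (P : PMF Ω)
    (X : Ω → α) (Y : Ω → β) (Z : Ω → γ) :
    entropy P (fun ω => (X ω, Y ω, Z ω)) + entropy P Z ≤
      entropy P (fun ω => (X ω, Z ω)) + entropy P (fun ω => (Y ω, Z ω)) := by
  set T : Ω → α × β × γ := fun ω => (X ω, Y ω, Z ω) with hT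
  have h1 := sum_negMulLog_prob_comp P T id
  have h2 := sum_negMulLog_prob_comp P T (fun x => x.2.2)
  have h3 := sum_negMulLog_prob_comp P T (fun x => (x.1, x.2.2))
  have h4 := sum_negMulLog_prob_comp P T (fun x => x.2)
  simp only [id, hT] at h1 h2 h3 h4
  simp only [entropy_eq_sum_div, ← add_div]
  refine div_le_div_of_nonneg_right ?_ (Real.log_nonneg one_le_two)
  rw [h1, h2, h3, h4]
  have l2 := fun x => prob_le_prob_comp P T (fun x => x.2.2) x
  have l3 := fun x => prob_le_prob_comp P T (fun x => (x.1, x.2.2)) x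
  have l4 := fun x => prob_le_prob_comp P T (fun x => x.2) x
  simp only [hT] at l2 l3 l4
  set p : α × β × γ → ℝ := fun x => prob P (fun ω => (X ω, Y ω, Z ω)) x with hp
  set pz : γ → ℝ := fun z => prob P Z z with hpz
  set pxz : α × γ → ℝ := fun z => prob P (fun ω => (X ω, Z ω)) z with hpxz
  set pyz : β × γ → ℝ := fun z => prob P (fun ω => (Y ω, Z ω)) z with hpyz
  have hswap : ∀ (α' : Type) [Fintype α'] (V : Ω → α') z,
      ∑ v, prob P (fun ω => (V ω, Z ω)) (v, z) = pz z := by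
    intro α' _ V z
    classical
    simp only [hpz]
    rw [prob_comp P (fun ω => (V ω, Z ω)) Prod.snd z, Fintype.sum_prod_type]
    refine Finset.sum_congr rfl fun v _ => ?_
    rw [Finset.sum_eq_single z]
    · simp
    · intro z' _ hz
      simp [Ne.symm hz]
    · simp
  have p0 : ∀ x, 0 ≤ p x := fun x => prob_nonneg _ _ _
  have z0 : ∀ x, 0 ≤ pz x := fun x => prob_nonneg _ _ _
  have xz0 : ∀ x, 0 ≤ pxz x := fun x => prob_nonneg _ _ _
  have yz0 : ∀ x, 0 ≤ pyz x := fun x => prob_nonneg _ _ _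
  have hpos : ∀ x, 0 < p x → 0 < pz x.2.2 ∧ 0 < pxz (x.1, x.2.2) ∧ 0 < pyz x.2 := fun x hx =>
    ⟨hx.trans_le (l2 x), hx.trans_le (l3 x), hx.trans_le (l4 x)⟩
  have gibbs := sum_mul_log_sub_log_nonneg (p := p)
    (q := fun x => pxz (x.1, x.2.2) * pyz x.2 / pz x.2.2) p0
    (fun x => div_nonneg (mul_nonneg (xz0 _) (yz0 _)) (z0 _))
    (fun x hx => by
      by_contra hne
      obtain ⟨a, b, c⟩ := hpos x ((p0 x).lt_of_ne (Ne.symm hne))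
      exact (div_pos (mul_pos b c) a).ne' hx)
    (by
      have : ∑ x, p x = 1 := sum_prob _ _
      rw [this, Fintype.sum_prod_type]
      simp only [Fintype.sum_prod_type]
      rw [Finset.sum_comm]
      have : ∀ y : β, ∑ x : α, ∑ z : γ, pxz (x, z) * pyz (y, z) / pz z = ∑ z, pyz (y, z) := by
        intro y
        rw [Finset.sum_comm]
        refine Finset.sum_congr rfl fun z _ => ?_
        have e : ∀ x, pxz (x, z) * pyz (y, z) / pz z = pxz (x, z) * (pyz (y, z) / pz z) :=
          fun x => mul_div_assoc _ _ _
        simp only [e]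
        rw [← Finset.sum_mul, hswap α X z]
        -- When p(z) = 0, every p(y,z) is a summand of zero, so both sides vanish.
        by_cases hz : pz z = 0
        · have := hswap β Y z
          rw [hz, Finset.sum_eq_zero_iff_of_nonneg (fun _ _ => yz0 _)] at this
          rw [hz, zero_mul]
          exact (this y (Finset.mem_univ y)).symm
        · field_simp
      simp only [this]
      rw [← Fintype.sum_prod_type (f := fun x : β × γ => pyz x)]
      exact (sum_prob _ _).le)
  have e : ∑ x, p x * (Real.log (p x) - Real.log (pxz (x.1, x.2.2) * pyz x.2 / pz x.2.2)) =
      ∑ x, (p x * Real.log (p x) + p x * Real.log (pz x.2.2)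
        - p x * Real.log (pxz (x.1, x.2.2)) - p x * Real.log (pyz x.2)) := by
    refine Finset.sum_congr rfl fun x _ => ?_
    rcases (p0 x).eq_or_lt with h | h
    · simp [← h]
    · obtain ⟨a, b, c⟩ := hpos x h
      rw [Real.log_div (mul_pos b c).ne' a.ne', Real.log_mul b.ne' c.ne']
      ring
  rw [e, Finset.sum_sub_distrib, Finset.sum_sub_distrib, Finset.sum_add_distrib] at gibbs
  linarith

/-- Submodularity of entropy. -/
lemma entropy_submodular [Fintype α] [Fintype β] [Fintype γ] [Fintype δ] {P : PMF Ω}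
    {X : Ω → α} {Y : Ω → β} (J : Ω → γ) (I : Ω → δ)
    (hJ : Determines P (fun ω => (X ω, Y ω)) J) (hX : Determines P X I) (hY : Determines P Y I) :
    entropy P J + entropy P I ≤ entropy P X + entropy P Y := by
  have h := entropy_triple_add_entropy_le P X Y I
  have e1 : entropy P (fun ω => (X ω, I ω)) = entropy P X := by
    refine Determines.entropy_eq (fun ω hω ω' hω' hh => ?_) (fun ω hω ω' hω' hh => ?_)
    · rw [hh, hX ω hω ω' hω' hh]
    · exact (Prod.ext_iff.1 hh).1
  have e2 : entropy P (fun ω => (Y ω, I ω)) = entropy P Y := by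
    refine Determines.entropy_eq (fun ω hω ω' hω' hh => ?_) (fun ω hω ω' hω' hh => ?_)
    · rw [hh, hY ω hω ω' hω' hh]
    · exact (Prod.ext_iff.1 hh).1
  have e3 : entropy P J ≤ entropy P (fun ω => (X ω, Y ω, I ω)) := by
    refine Determines.entropy_le (fun ω hω ω' hω' hh => hJ ω hω ω' hω' ?_)
    simp only [Prod.mk.injEq] at hh ⊢
    exact ⟨hh.1, hh.2.1⟩
  linarith

lemma log_two_pos : 0 < Real.log 2 := Real.log_pos one_lt_two

/-- Gibbs' inequality against the uniform law. -/
lemma entropy_le_logb_card [Fintype α] (P : PMF Ω) (X : Ω → α) :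
    entropy P X ≤ Real.log (Fintype.card α) / Real.log 2 := by
  obtain ⟨ω₀, -⟩ := P.support_nonempty
  have : Nonempty α := ⟨X ω₀⟩
  have hc : (0 : ℝ) < Fintype.card α := by exact_mod_cast Fintype.card_pos
  have h := sum_mul_log_sub_log_nonneg (p := prob P X) (q := fun _ => (Fintype.card α : ℝ)⁻¹)
    (fun _ => prob_nonneg _ _ _) (fun _ => by positivity)
    (fun _ h => absurd h (by positivity)) (by
      rw [sum_prob, Finset.sum_const, Finset.card_univ, nsmul_eq_mul, mul_inv_cancel₀ hc.ne'])
  rw [entropy_eq_sum_div]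
  refine div_le_div_of_nonneg_right ?_ log_two_pos.le
  simp only [mul_sub, Finset.sum_sub_distrib, ← Finset.sum_mul, sum_prob, one_mul,
    Real.log_inv] at h
  simp only [Real.negMulLog, neg_mul, Finset.sum_neg_distrib]
  linarith

lemma entropy_bits_le {ι : Type} [Fintype ι] [DecidableEq ι] (P : PMF Ω) (X : Ω → ι → Bool) :
    entropy P X ≤ Fintype.card ι := by
  refine (entropy_le_logb_card P X).trans_eq ?_
  rw [Fintype.card_fun, Fintype.card_bool]
  push_cast
  rw [Real.log_pow, mul_div_assoc, div_self log_two_pos.ne', mul_one]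

lemma entropy_of_uniform [Fintype α] [Nonempty α] {P : PMF Ω} {X : Ω → α}
    (h : P.map X = PMF.uniformOfFintype α) :
    entropy P X = Real.log (Fintype.card α) / Real.log 2 := by
  have hc : (0 : ℝ) < Fintype.card α := by exact_mod_cast Fintype.card_pos
  have hp : ∀ x, prob P X x = (Fintype.card α : ℝ)⁻¹ := by
    intro x
    rw [prob, h, PMF.uniformOfFintype_apply]
    simp
  rw [entropy_eq_sum_div]
  simp only [hp, Finset.sum_const, Finset.card_univ, nsmul_eq_mul, Real.negMulLog, Real.log_inv]
  field_simp

/-- Entropy of a mixture, when the mixing variable is read off from the outcome. -/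
lemma entropy_bind [Fintype Θ] [Fintype α] (p : PMF Θ) (κ : Θ → PMF Ω) (T : Ω → Θ) (X : Ω → α)
    (hT : ∀ t, ∀ ω ∈ (κ t).support, T ω = t) :
    entropy (p.bind κ) (fun ω => (T ω, X ω)) =
      entropy p id + ∑ t, (p t).toReal * entropy (κ t) X := by
  classical
  have h1 : ∀ t x, prob (p.bind κ) (fun ω => (T ω, X ω)) (t, x) =
      (p t).toReal * prob (κ t) X x := by
    intro t x
    rw [prob_bind, Finset.sum_eq_single t]
    · congr 1
      have : (κ t).map (fun ω => (T ω, X ω)) = (κ t).map (fun ω => (fun x => (t, x)) (X ω)) :=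
        map_congr_support _ fun ω hω => by rw [hT t ω hω]
      rw [prob, this]
      change prob (κ t) (fun ω => (fun x => (t, x)) (X ω)) (t, x) = _
      rw [prob_comp]
      simp
    · intro t' _ ht'
      have : prob (κ t') (fun ω => (T ω, X ω)) (t, x) = 0 := by
        rw [prob, ENNReal.toReal_eq_zero_iff]
        left
        rw [PMF.apply_eq_zero_iff, PMF.mem_support_map_iff]
        rintro ⟨ω, hω, he⟩
        exact ht' ((hT t' ω hω).symm.trans (Prod.ext_iff.1 he).1)
      rw [this, mul_zero]
    · simp
  have h2 : ∀ t, prob p id t = (p t).toReal := fun t => by rw [prob, PMF.map_id]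
  simp only [entropy_eq_sum_div, h2]
  rw [Fintype.sum_prod_type]
  simp only [h1, Real.negMulLog_mul, Finset.sum_add_distrib, ← Finset.sum_mul, sum_prob,
    ← Finset.mul_sum]
  rw [add_div, Finset.sum_div]
  simp only [one_mul, mul_div_assoc]

lemma entropy_bind_of_const [Fintype Θ] [Fintype α] (p : PMF Θ) (κ : Θ → PMF Ω) (T : Ω → Θ)
    (X : Ω → α) (hT : ∀ t, ∀ ω ∈ (κ t).support, T ω = t) {c : ℝ}
    (hc : ∀ t, entropy (κ t) X = c) :
    entropy (p.bind κ) (fun ω => (T ω, X ω)) = entropy p id + c := by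
  rw [entropy_bind p κ T X hT]
  simp only [hc, ← Finset.sum_mul, sum_toReal_eq_one, one_mul]

lemma entropy_const [Fintype α] (P : PMF Ω) (a : α) : entropy P (fun _ => a) = 0 := by
  classical
  have h : ∀ x, prob P (fun _ : Ω => a) x = if x = a then 1 else 0 := by
    intro x
    have : P.map (fun _ => a) = PMF.pure a := P.map_const a
    rw [prob, this, PMF.pure_apply]
    split_ifs <;> simp
  rw [entropy_eq_sum_div, Finset.sum_eq_zero, zero_div]
  intro x _
  rw [h]
  split_ifs <;> simp

lemma entropy_bind_index [Fintype Θ] (p : PMF Θ) (κ : Θ → PMF Ω) (T : Ω → Θ)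
    (hT : ∀ t, ∀ ω ∈ (κ t).support, T ω = t) : entropy (p.bind κ) T = entropy p id := by
  have h := entropy_bind_of_const p κ T (fun _ => ()) hT (fun t => entropy_const (κ t) ())
  rw [add_zero] at h
  rw [← h]
  exact Determines.entropy_eq (fun ω _ ω' _ hh => (Prod.ext_iff.1 hh).1)
    (fun ω _ ω' _ hh => by rw [hh])

/-- If the index of a mixture with full support is independent of `X` in the sense of mutual
information, then `X` has the same law in all components. -/
lemma prob_eq_of_mutualInfo_eq_zero [Fintype Θ] [Fintype α] (p : PMF Θ) (hp : ∀ t, p t ≠ 0)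
    (κ : Θ → PMF Ω) (T : Ω → Θ) (X : Ω → α) (hT : ∀ t, ∀ ω ∈ (κ t).support, T ω = t)
    (hI : mutualInfo (p.bind κ) T X = 0) (t : Θ) (x : α) :
    prob (κ t) X x = prob (p.bind κ) X x := by
  have hI' : entropy (p.bind κ) X = ∑ t, (p t).toReal * entropy (κ t) X := by
    rw [mutualInfo, condEntropy, entropy_bind p κ T X hT, entropy_bind_index p κ T hT] at hI
    linarith
  have hpos : ∀ t, 0 < (p t).toReal := fun t => ENNReal.toReal_pos (hp t) (p.apply_ne_top t)
  simp only [entropy_eq_sum_div] at hI'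
  have hI2 : ∑ x, Real.negMulLog (prob (p.bind κ) X x) =
      ∑ x, ∑ t, (p t).toReal * Real.negMulLog (prob (κ t) X x) := by
    rw [Finset.sum_comm]
    simp only [← mul_div_assoc, ← Finset.sum_div] at hI'
    simp only [← Finset.mul_sum]
    exact (div_left_inj' log_two_pos.ne').1 hI'
  have hle : ∀ x ∈ (univ : Finset α), ∑ t, (p t).toReal * Real.negMulLog (prob (κ t) X x) ≤
      Real.negMulLog (prob (p.bind κ) X x) := by
    intro x _
    rw [prob_bind]
    exact Real.concaveOn_negMulLog.le_map_sum (fun t _ => (hpos t).le) (sum_toReal_eq_one p)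
      (fun t _ => prob_nonneg _ _ _)
  -- Jensen holds for each value and the sums agree, so it is an equality for each value; strict
  -- concavity with positive weights then equates the components.
  have heq := (Finset.sum_eq_sum_iff_of_le hle).1 hI2.symm x (Finset.mem_univ x)
  rw [prob_bind]
  refine (Real.strictConcaveOn_negMulLog.map_sum_eq_iff (t := univ) (w := fun t => (p t).toReal)
    (p := fun t => prob (κ t) X x) (fun t _ => hpos t) (sum_toReal_eq_one p)
      (fun t _ => prob_nonneg _ _ _)).1 ?_ t (Finset.mem_univ t)
  rw [prob_bind] at heq
  exact heq.symm

/-- Subadditivity of conditional entropy over a finite family. -/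
lemma entropy_pi_prod_le {ι : Type} [Fintype ι] [DecidableEq ι] {A : ι → Type}
    [∀ i, Fintype (A i)] [Fintype γ] (P : PMF Ω) (X : ∀ i, Ω → A i) (Z : Ω → γ) :
    entropy P (fun ω => ((fun i => X i ω), Z ω)) - entropy P Z ≤
      ∑ i, (entropy P (fun ω => (X i ω, Z ω)) - entropy P Z) := by
  have key : ∀ s : Finset ι, entropy P (fun ω => ((fun i : {i // i ∈ s} => X i ω), Z ω)) -
      entropy P Z ≤ ∑ i ∈ s, (entropy P (fun ω => (X i ω, Z ω)) - entropy P Z) := by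
    intro s
    induction s using Finset.induction_on with
    | empty =>
      rw [Finset.sum_empty, sub_nonpos]
      refine Determines.entropy_le fun ω _ ω' _ h => ?_
      simp only [h, Prod.mk.injEq, and_true]
      funext i
      exact absurd i.2 (Finset.notMem_empty _)
    | insert a s ha ih =>
      rw [Finset.sum_insert ha]
      have := entropy_submodular (P := P) (X := fun ω => (X a ω, Z ω))
        (Y := fun ω => ((fun i : {i // i ∈ s} => X i ω), Z ω))
        (fun ω => ((fun i : {i // i ∈ insert a s} => X i ω), Z ω)) Z
        (fun ω _ ω' _ h => by
          simp only [Prod.mk.injEq] at h ⊢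
          refine ⟨?_, h.1.2⟩
          funext ⟨i, hi⟩
          rcases Finset.mem_insert.1 hi with rfl | hi
          · exact h.1.1
          · exact congrFun h.2.1 ⟨i, hi⟩)
        (fun ω _ ω' _ h => (Prod.ext_iff.1 h).2) (fun ω _ ω' _ h => (Prod.ext_iff.1 h).2)
      linarith
  refine le_trans (sub_le_sub_right ?_ _) (key univ)
  refine Determines.entropy_le fun ω _ ω' _ h => ?_
  simp only [Prod.mk.injEq] at h ⊢
  refine ⟨?_, h.2⟩
  funext i
  exact congrFun h.1 ⟨i, Finset.mem_univ i⟩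

end Entropy

end

end MuPIR

/-! ### Laws for a fixed demand, and entropies of library bits. -/

namespace MuPIR

noncomputable section

namespace UncodedScheme

variable {K U N L : ℕ} (S : UncodedScheme K U N L)

/-- Law of the outcome given the demand vector. -/
def lawGiven (θ : Demand K U) : PMF S.Outcome :=
  (PMF.uniformOfFintype (Messages K L)).bind fun W =>
    (S.queryLaw θ (S.cacheContent W)).map fun q => (θ, W, q)

lemma jointLaw_eq_bind (p : PMF (Demand K U)) : S.jointLaw p = p.bind S.lawGiven := rfl

lemma demandRV_of_mem_support {θ : Demand K U} {ω : S.Outcome}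
    (hω : ω ∈ (S.lawGiven θ).support) : S.demandRV ω = θ := by
  simp only [lawGiven, PMF.mem_support_bind_iff, PMF.mem_support_map_iff] at hω
  obtain ⟨W, -, q, -, rfl⟩ := hω
  rfl

lemma map_messagesRV_lawGiven (θ : Demand K U) :
    (S.lawGiven θ).map S.messagesRV = PMF.uniformOfFintype (Messages K L) := by
  rw [lawGiven, PMF.map_bind]
  have : ∀ W : Messages K L, ((S.queryLaw θ (S.cacheContent W)).map fun q => (θ, W, q)).map
      S.messagesRV = PMF.pure W := by
    intro W
    rw [PMF.map_comp]
    exact PMF.map_const _ _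
  simp only [this, PMF.bind_pure]

lemma entropy_messagesRV (θ : Demand K U) :
    entropy (S.lawGiven θ) S.messagesRV = K * L := by
  rw [entropy_of_uniform (S.map_messagesRV_lawGiven θ)]
  simp only [Messages, Fintype.card_fun, Fintype.card_bool, Fintype.card_fin]
  push_cast
  rw [← pow_mul, Real.log_pow, mul_div_assoc, div_self log_two_pos.ne']
  push_cast
  ring

/-- The library bits at the positions in `T`. -/
def bitsRV (T : Finset (Fin K × Fin L)) (ω : S.Outcome) : {b // b ∈ T} → Bool :=
  fun b => ω.2.1 b.1.1 b.1.2

/-- The message `W_i`. -/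
def messageRV (i : Fin K) (ω : S.Outcome) : Fin L → Bool := ω.2.1 i

/-- The bits in `T` and in its complement have entropy at most their numbers, yet together they
carry all `K * L` bits, so both bounds are tight. -/
lemma entropy_bitsRV (θ : Demand K U) (T : Finset (Fin K × Fin L)) :
    entropy (S.lawGiven θ) (S.bitsRV T) = T.card := by
  have hle : ∀ T : Finset (Fin K × Fin L), entropy (S.lawGiven θ) (S.bitsRV T) ≤ T.card :=
    fun T => (entropy_bits_le _ _).trans_eq (by rw [Fintype.card_coe])
  have h := entropy_submodular (P := S.lawGiven θ) (X := S.bitsRV T) (Y := S.bitsRV Tᶜ)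
    S.messagesRV (fun _ => ())
    (fun ω _ ω' _ hh => by
      funext i l
      by_cases hT : (i, l) ∈ T
      · exact congrFun (Prod.ext_iff.1 hh).1 ⟨(i, l), hT⟩
      · exact congrFun (Prod.ext_iff.1 hh).2 ⟨(i, l), Finset.mem_compl.2 hT⟩)
    (fun _ _ _ _ _ => rfl) (fun _ _ _ _ _ => rfl)
  rw [entropy_messagesRV, entropy_const] at h
  have h1 := hle T
  have h2 := hle Tᶜ
  have h3 : ((T.card : ℝ)) + (Tᶜ.card : ℝ) = K * L := by
    have := Finset.card_add_card_compl T
    rw [Fintype.card_prod, Fintype.card_fin, Fintype.card_fin] at this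
    exact_mod_cast this
  linarith

/-! ### Entropy consequences of decodability, cache independence and privacy. -/

section Constraints

variable {S} {p : PMF (Demand K U)}

lemma entropy_demandRV_prod {α : Type} [Fintype α] (X : S.Outcome → α) :
    entropy (S.jointLaw p) (fun ω => (S.demandRV ω, X ω)) =
      entropy p id + ∑ θ, (p θ).toReal * entropy (S.lawGiven θ) X :=
  entropy_bind p S.lawGiven S.demandRV X fun _ _ h => S.demandRV_of_mem_support h

lemma eq_zero_of_sum_toReal_mul_eq_zero {Θ : Type} [Fintype Θ] {p : PMF Θ} (hp : ∀ t, p t ≠ 0)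
    {f : Θ → ℝ} (hf : ∀ t, 0 ≤ f t) (h : ∑ t, (p t).toReal * f t = 0) (t : Θ) : f t = 0 := by
  rw [Finset.sum_eq_zero_iff_of_nonneg
    (fun t _ => mul_nonneg ENNReal.toReal_nonneg (hf t))] at h
  exact (mul_eq_zero.1 (h t (Finset.mem_univ t))).resolve_left
    (ENNReal.toReal_pos (hp t) (p.apply_ne_top t)).ne'

/-- The required conditional entropy is an average over demands of nonnegative terms; full support
forces each term to vanish. -/
lemma Decodable.entropy_lawGiven_eq (h : S.Decodable p) (hp : ∀ θ, p θ ≠ 0) (θ : Demand K U)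
    (k : Fin U) :
    entropy (S.lawGiven θ)
      (fun ω => (S.messageRV (θ k) ω, S.queriesRV ω, S.answersRV ω, S.cacheRV k ω)) =
    entropy (S.lawGiven θ) (fun ω => (S.queriesRV ω, S.answersRV ω, S.cacheRV k ω)) := by
  have h' := h k
  have e : entropy (S.jointLaw p) (fun ω => (S.wantedRV k ω,
      (S.demandRV ω, S.queriesRV ω, S.answersRV ω, S.cacheRV k ω))) =
      entropy (S.jointLaw p) (fun ω => (S.demandRV ω,
        (S.wantedRV k ω, S.queriesRV ω, S.answersRV ω, S.cacheRV k ω))) := by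
    refine Determines.entropy_eq (fun ω _ ω' _ hh => ?_) (fun ω _ ω' _ hh => ?_) <;>
    · simp only [Prod.mk.injEq] at hh ⊢
      tauto
  rw [condEntropy, e, entropy_demandRV_prod, entropy_demandRV_prod, add_sub_add_left_eq_sub,
    ← Finset.sum_sub_distrib] at h'
  simp only [← mul_sub] at h'
  have h2 := eq_zero_of_sum_toReal_mul_eq_zero hp (fun t => sub_nonneg.2 <|
    Determines.entropy_le fun ω _ ω' _ hh => (Prod.ext_iff.1 hh).2) h' θ
  rw [← sub_eq_zero, ← h2]
  congr 1
  refine entropy_congr_support _ fun ω hω => ?_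
  have hd := S.demandRV_of_mem_support hω
  simp only [messageRV, wantedRV, ← hd]
  rfl

lemma determines_cacheRV (P : PMF S.Outcome) (k : Fin U) :
    Determines P S.messagesRV (S.cacheRV k) := fun ω _ ω' _ h => by
  simp only [messagesRV] at h
  simp only [cacheRV, h]

/-- This is I(Q; W | Z_k) = 0 for one fixed demand: the averaged quantity has nonnegative terms by
submodularity and all weights are positive. -/
lemma NoSideChannel.entropy_lawGiven_eq (h : S.NoSideChannel p) (hp : ∀ θ, p θ ≠ 0)
    (θ : Demand K U) (k : Fin U) :
    entropy (S.lawGiven θ) (fun ω => (S.queriesRV ω, S.messagesRV ω)) +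
        entropy (S.lawGiven θ) (S.cacheRV k) =
      entropy (S.lawGiven θ) (fun ω => (S.queriesRV ω, S.cacheRV k ω)) +
        entropy (S.lawGiven θ) S.messagesRV := by
  have h' := h k
  have e1 : entropy (S.jointLaw p) (fun ω => (S.queriesRV ω, (S.demandRV ω, S.cacheRV k ω))) =
      entropy (S.jointLaw p) (fun ω => (S.demandRV ω, (S.queriesRV ω, S.cacheRV k ω))) := by
    refine Determines.entropy_eq (fun ω _ ω' _ hh => ?_) (fun ω _ ω' _ hh => ?_) <;>
    · simp only [Prod.mk.injEq] at hh ⊢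
      tauto
  have e2 : entropy (S.jointLaw p)
        (fun ω => (S.queriesRV ω, (S.messagesRV ω, (S.demandRV ω, S.cacheRV k ω)))) =
      entropy (S.jointLaw p) (fun ω => (S.demandRV ω, (S.queriesRV ω, S.messagesRV ω))) := by
    refine Determines.entropy_eq (fun ω hω ω' hω' hh => ?_) (fun ω _ ω' _ hh => ?_)
    · simp only [Prod.mk.injEq] at hh ⊢
      have := determines_cacheRV _ k ω hω ω' hω' hh.2.2
      tauto
    · simp only [Prod.mk.injEq] at hh ⊢
      tauto
  have e3 : entropy (S.jointLaw p)
        (fun ω => (S.messagesRV ω, (S.demandRV ω, S.cacheRV k ω))) =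
      entropy (S.jointLaw p) (fun ω => (S.demandRV ω, S.messagesRV ω)) := by
    refine Determines.entropy_eq (fun ω hω ω' hω' hh => ?_) (fun ω _ ω' _ hh => ?_)
    · simp only [Prod.mk.injEq] at hh ⊢
      have := determines_cacheRV _ k ω hω ω' hω' hh.2
      tauto
    · simp only [Prod.mk.injEq] at hh ⊢
      tauto
  rw [condMutualInfo, condEntropy, condEntropy, e1, e2, e3] at h'
  simp only [entropy_demandRV_prod, add_sub_add_left_eq_sub, ← Finset.sum_sub_distrib,
    ← mul_sub] at h'
  have h2 := eq_zero_of_sum_toReal_mul_eq_zero hp (fun t => ?_) h' θ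
  · linarith
  · have := entropy_submodular (P := S.lawGiven t)
      (X := fun ω => (S.queriesRV ω, S.cacheRV k ω)) (Y := S.messagesRV)
      (fun ω => (S.queriesRV ω, S.messagesRV ω)) (S.cacheRV k)
      (fun ω _ ω' _ hh => by
        simp only [Prod.mk.injEq] at hh ⊢
        tauto)
      (fun ω _ ω' _ hh => (Prod.ext_iff.1 hh).2) (determines_cacheRV _ k)
    linarith

/-- By privacy, every function of what database `n` sees, the messages and the caches has an
entropy that does not depend on the demands. -/
lemma Private.entropy_lawGiven_comp_eq (h : S.Private p) (hp : ∀ θ, p θ ≠ 0) (θ : Demand K U)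
    (n : Fin N) {α : Type} [Fintype α]
    (f : S.Query n × S.Answer n × Messages K L × ((k : Fin U) → {b // b ∈ S.cache k} → Bool) → α) :
    entropy (S.lawGiven θ)
      (fun ω => f (S.queryRV n ω, S.answerRV n ω, S.messagesRV ω, S.cachesRV ω)) =
    entropy (S.jointLaw p)
      (fun ω => f (S.queryRV n ω, S.answerRV n ω, S.messagesRV ω, S.cachesRV ω)) :=
  entropy_congr_comp (prob_eq_of_mutualInfo_eq_zero p hp S.lawGiven S.demandRV _
    (fun _ _ hω => S.demandRV_of_mem_support hω) (h n) θ) f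

/-- Given any function `X` of the messages that includes a cache, the messages and the queries are
independent. -/
lemma NoSideChannel.entropy_queriesRV_prod (h : S.NoSideChannel p) (hp : ∀ θ, p θ ≠ 0)
    (θ : Demand K U) (k : Fin U) {α : Type} [Fintype α] {X : S.Outcome → α}
    (hWX : Determines (S.lawGiven θ) S.messagesRV X)
    (hXZ : Determines (S.lawGiven θ) X (S.cacheRV k)) :
    entropy (S.lawGiven θ) (fun ω => (S.queriesRV ω, X ω)) = entropy (S.lawGiven θ) X +
      (entropy (S.lawGiven θ) (fun ω => (S.queriesRV ω, S.messagesRV ω)) -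
        entropy (S.lawGiven θ) S.messagesRV) := by
  have h0 := h.entropy_lawGiven_eq hp θ k
  -- Since X lies between Z_k and W, H(Q | W) ≤ H(Q | X) ≤ H(Q | Z_k); the outer terms agree by
  -- `h0`.
  have h1 := entropy_submodular (P := S.lawGiven θ)
    (X := fun ω => (S.queriesRV ω, S.cacheRV k ω)) (Y := X)
    (fun ω => (S.queriesRV ω, X ω)) (S.cacheRV k)
    (fun ω _ ω' _ hh => by
      simp only [Prod.mk.injEq] at hh ⊢
      tauto)
    (fun ω _ ω' _ hh => (Prod.ext_iff.1 hh).2) hXZ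
  have h2 := entropy_submodular (P := S.lawGiven θ)
    (X := fun ω => (S.queriesRV ω, X ω)) (Y := S.messagesRV)
    (fun ω => (S.queriesRV ω, S.messagesRV ω)) X
    (fun ω _ ω' _ hh => by
      simp only [Prod.mk.injEq] at hh ⊢
      tauto)
    (fun ω _ ω' _ hh => (Prod.ext_iff.1 hh).2) hWX
  linarith

/-- Side information of user `k` after decoding message `i`. -/
def sideRV (S : UncodedScheme K U N L) (k : Fin U) (i : Fin K) (ω : S.Outcome) :
    (Fin L → Bool) × ({b // b ∈ S.cache k} → Bool) :=
  (S.messageRV i ω, S.cacheRV k ω)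

lemma determines_sideRV (P : PMF S.Outcome) (k : Fin U) (i : Fin K) :
    Determines P S.messagesRV (S.sideRV k i) := fun ω _ ω' _ h => by
  simp only [messagesRV] at h
  simp only [sideRV, messageRV, cacheRV, h]

/-- The load uses answer laws averaged over demands; by privacy these are also the laws under any
fixed demand, where subadditivity applies. -/
lemma entropy_answersRV_le (h : S.Private p) (hp : ∀ θ, p θ ≠ 0) (hL : 0 < L)
    (θ : Demand K U) : entropy (S.lawGiven θ) S.answersRV ≤ S.load p * L := by
  have h1 := entropy_pi_prod_le (S.lawGiven θ) S.answerRV (fun _ => ())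
  simp only [entropy_const, sub_zero] at h1
  rw [load, div_mul_cancel₀ _ (by exact_mod_cast hL.ne')]
  refine le_trans (Determines.entropy_le fun ω _ ω' _ hh => (Prod.ext_iff.1 hh).1) (h1.trans ?_)
  refine Finset.sum_le_sum fun n _ => ?_
  refine le_trans (Determines.entropy_le (Y := S.answerRV n) fun ω _ ω' _ hh => by rw [hh]) ?_
  exact (h.entropy_lawGiven_comp_eq hp θ n fun x => x.2.1).le

/-- The first decoding step: user `k` recovers its message from the answers. -/
lemma entropy_wanted_add_le (hd : S.Decodable p) (hs : S.NoSideChannel p) (hp : ∀ θ, p θ ≠ 0)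
    (θ : Demand K U) (k : Fin U) :
    entropy (S.lawGiven θ) (S.sideRV k (θ k)) - entropy (S.lawGiven θ) (S.cacheRV k) +
      (entropy (S.lawGiven θ) (fun ω => (S.answersRV ω, S.queriesRV ω, S.sideRV k (θ k) ω)) -
       entropy (S.lawGiven θ) (fun ω => (S.queriesRV ω, S.sideRV k (θ k) ω))) ≤
      entropy (S.lawGiven θ) S.answersRV := by
  have h0 := hs.entropy_queriesRV_prod hp θ k (determines_sideRV _ k (θ k))
    (fun ω _ ω' _ hh => (Prod.ext_iff.1 hh).2)
  have h0' := hs.entropy_queriesRV_prod hp θ k (determines_cacheRV _ k) (fun ω _ ω' _ hh => hh)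
  have h1 := hd.entropy_lawGiven_eq hp θ k
  -- This is H(A) ≥ H(A | Q, Z_k). Decoding then inserts W_i at no cost, and independence of queries
  -- and messages given the cache removes Q from the difference.
  have h2 := entropy_submodular (P := S.lawGiven θ) (X := S.answersRV)
    (Y := fun ω => (S.queriesRV ω, S.cacheRV k ω))
    (fun ω => (S.queriesRV ω, S.answersRV ω, S.cacheRV k ω)) (fun _ => ())
    (fun ω _ ω' _ hh => by
      simp only [Prod.mk.injEq] at hh ⊢
      tauto)
    (fun _ _ _ _ _ => rfl) (fun _ _ _ _ _ => rfl)
  have h3 : entropy (S.lawGiven θ)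
      (fun ω => (S.answersRV ω, S.queriesRV ω, S.sideRV k (θ k) ω)) ≤
      entropy (S.lawGiven θ)
      (fun ω => (S.messageRV (θ k) ω, S.queriesRV ω, S.answersRV ω, S.cacheRV k ω)) :=
    Determines.entropy_le fun ω _ ω' _ hh => by
      simp only [Prod.mk.injEq, sideRV] at hh ⊢
      tauto
  rw [entropy_const] at h2
  linarith

/-- From all queries and answers, one message, and a cache that suffices to decode the other
message, all messages are determined. -/
lemma entropy_messages_le_of_decode (hd : S.Decodable p) (hp : ∀ θ, p θ ≠ 0) (θ : Demand K U)
    (k : Fin U) {α : Type} [Fintype α] {X : S.Outcome → α} {i : Fin K}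
    (hi : ∀ j, j = i ∨ j = θ k) (hXi : Determines (S.lawGiven θ) X (S.messageRV i))
    (hXZ : Determines (S.lawGiven θ) X (S.cacheRV k)) :
    entropy (S.lawGiven θ) (fun ω => (S.queriesRV ω, S.messagesRV ω)) ≤
      entropy (S.lawGiven θ) (fun ω => (S.answersRV ω, S.queriesRV ω, X ω)) := by
  have h1 := hd.entropy_lawGiven_eq hp θ k
  have h2 := entropy_submodular (P := S.lawGiven θ)
    (X := fun ω => (S.answersRV ω, S.queriesRV ω, X ω))
    (Y := fun ω => (S.messageRV (θ k) ω, S.queriesRV ω, S.answersRV ω, S.cacheRV k ω))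
    (fun ω => (S.queriesRV ω, S.messagesRV ω))
    (fun ω => (S.queriesRV ω, S.answersRV ω, S.cacheRV k ω))
    (fun ω hω ω' hω' hh => by
      simp only [Prod.mk.injEq] at hh ⊢
      refine ⟨hh.1.2.1, ?_⟩
      funext j
      rcases hi j with rfl | rfl
      · exact hXi ω hω ω' hω' hh.1.2.2
      · exact hh.2.1)
    (fun ω hω ω' hω' hh => by
      simp only [Prod.mk.injEq] at hh ⊢
      exact ⟨hh.2.1, hh.1, hXZ ω hω ω' hω' hh.2.2⟩)
    (fun ω _ ω' _ hh => (Prod.ext_iff.1 hh).2)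
  linarith

/-- The second decoding step with the help of the cache of a user `k'` who wants the other
message. -/
lemma entropy_le_of_second_user (hd : S.Decodable p) (hs : S.NoSideChannel p)
    (hp : ∀ θ, p θ ≠ 0) (θ : Demand K U) (k k' : Fin U) (hk : ∀ j, j = θ k ∨ j = θ k') :
    entropy (S.lawGiven θ) S.messagesRV -
        entropy (S.lawGiven θ) (fun ω => (S.sideRV k (θ k) ω, S.cacheRV k' ω)) ≤
      entropy (S.lawGiven θ) (fun ω => (S.answersRV ω, S.queriesRV ω, S.sideRV k (θ k) ω)) -
       entropy (S.lawGiven θ) (fun ω => (S.queriesRV ω, S.sideRV k (θ k) ω)) := by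
  have h0 := hs.entropy_queriesRV_prod hp θ k
    (X := fun ω => (S.sideRV k (θ k) ω, S.cacheRV k' ω))
    (fun ω hω ω' hω' hh => Prod.ext (determines_sideRV _ k (θ k) ω hω ω' hω' hh)
      (determines_cacheRV _ k' ω hω ω' hω' hh))
    (fun ω _ ω' _ hh => (Prod.ext_iff.1 (Prod.ext_iff.1 hh).1).2)
  have h1 := entropy_messages_le_of_decode hd hp θ k'
    (X := fun ω => (S.sideRV k (θ k) ω, S.cacheRV k' ω)) hk
    (fun ω _ ω' _ hh => (Prod.ext_iff.1 (Prod.ext_iff.1 hh).1).1)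
    (fun ω _ ω' _ hh => (Prod.ext_iff.1 hh).2)
  have h2 := entropy_submodular (P := S.lawGiven θ)
    (X := fun ω => (S.answersRV ω, S.queriesRV ω, S.sideRV k (θ k) ω))
    (Y := fun ω => (S.queriesRV ω, S.sideRV k (θ k) ω, S.cacheRV k' ω))
    (fun ω => (S.answersRV ω, S.queriesRV ω, S.sideRV k (θ k) ω, S.cacheRV k' ω))
    (fun ω => (S.queriesRV ω, S.sideRV k (θ k) ω))
    (fun ω _ ω' _ hh => by
      simp only [Prod.mk.injEq] at hh ⊢
      tauto)
    (fun ω _ ω' _ hh => (Prod.ext_iff.1 hh).2)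
    (fun ω _ ω' _ hh => by
      simp only [Prod.mk.injEq] at hh ⊢
      tauto)
  linarith

/-- What the answer of a single database reveals given side information is bounded by what all
answers reveal, and it depends only on the query to that database. -/
lemma entropy_answerRV_sub_le (hs : S.NoSideChannel p) (hp : ∀ θ, p θ ≠ 0)
    (θ : Demand K U) (k : Fin U) (i : Fin K) (n : Fin N) :
    entropy (S.lawGiven θ) (fun ω => (S.answerRV n ω, S.queryRV n ω, S.sideRV k i ω)) -
        entropy (S.lawGiven θ) (fun ω => (S.queryRV n ω, S.sideRV k i ω)) ≤
      entropy (S.lawGiven θ) (fun ω => (S.answersRV ω, S.queriesRV ω, S.sideRV k i ω)) -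
        entropy (S.lawGiven θ) (fun ω => (S.queriesRV ω, S.sideRV k i ω)) := by
  have hq : ∀ ω ω' : S.Outcome, S.queriesRV ω = S.queriesRV ω' →
      S.queryRV n ω = S.queryRV n ω' := fun ω ω' hh => congrFun hh n
  have h0 := hs.entropy_queriesRV_prod hp θ k (determines_sideRV _ k i)
    (fun ω _ ω' _ hh => (Prod.ext_iff.1 hh).2)
  -- A_n is a function of (W, Q_n), and given the side information Q is independent of W. Hence
  -- passing from Q_n to all of Q does not reduce the information in A_n.
  have h1 := entropy_submodular (P := S.lawGiven θ)
    (X := fun ω => (S.answersRV ω, S.queriesRV ω, S.sideRV k i ω))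
    (Y := fun ω => (S.messagesRV ω, S.queryRV n ω))
    (fun ω => (S.queriesRV ω, S.messagesRV ω))
    (fun ω => (S.answerRV n ω, S.queryRV n ω, S.sideRV k i ω))
    (fun ω _ ω' _ hh => by
      simp only [Prod.mk.injEq] at hh ⊢
      tauto)
    (fun ω _ ω' _ hh => by
      simp only [Prod.mk.injEq] at hh ⊢
      exact ⟨congrFun hh.1 n, hq _ _ hh.2.1, hh.2.2⟩)
    (fun ω hω ω' hω' hh => by
      simp only [Prod.mk.injEq] at hh ⊢
      refine ⟨?_, hh.2, determines_sideRV _ k i ω hω ω' hω' hh.1⟩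
      have h1 := hh.1
      have h2 := hh.2
      simp only [messagesRV, queryRV] at h1 h2
      simp only [answerRV, h1, h2])
  have h2 := entropy_submodular (P := S.lawGiven θ)
    (X := fun ω => (S.queryRV n ω, S.sideRV k i ω)) (Y := S.messagesRV)
    (fun ω => (S.messagesRV ω, S.queryRV n ω)) (S.sideRV k i)
    (fun ω _ ω' _ hh => by
      simp only [Prod.mk.injEq] at hh ⊢
      tauto)
    (fun ω _ ω' _ hh => (Prod.ext_iff.1 hh).2) (determines_sideRV _ k i)
  linarith

/-- The second decoding step with the help of privacy: for other demands, the databases would have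
to reveal the other message, and each of them behaves in the same way for these demands. -/
lemma entropy_le_of_private (hd : S.Decodable p) (hs : S.NoSideChannel p) (hpr : S.Private p)
    (hp : ∀ θ, p θ ≠ 0) (θ θ' : Demand K U) (k : Fin U) (hk : ∀ j, j = θ k ∨ j = θ' k) :
    entropy (S.lawGiven θ') S.messagesRV - entropy (S.lawGiven θ') (S.sideRV k (θ k)) ≤
      N * (entropy (S.lawGiven θ)
          (fun ω => (S.answersRV ω, S.queriesRV ω, S.sideRV k (θ k) ω)) -
        entropy (S.lawGiven θ) (fun ω => (S.queriesRV ω, S.sideRV k (θ k) ω))) := by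
  set i := θ k
  have h0 := hs.entropy_queriesRV_prod hp θ' k (determines_sideRV _ k i)
    (fun ω _ ω' _ hh => (Prod.ext_iff.1 hh).2)
  have h1 := entropy_messages_le_of_decode hd hp θ' k (X := S.sideRV k i) hk
    (fun ω _ ω' _ hh => (Prod.ext_iff.1 hh).1) (fun ω _ ω' _ hh => (Prod.ext_iff.1 hh).2)
  have h2 := entropy_pi_prod_le (S.lawGiven θ') S.answerRV
    (fun ω => (S.queriesRV ω, S.sideRV k i ω))
  have h3 : ∀ n ∈ (univ : Finset (Fin N)), entropy (S.lawGiven θ')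
        (fun ω => (S.answerRV n ω, S.queriesRV ω, S.sideRV k i ω)) -
      entropy (S.lawGiven θ') (fun ω => (S.queriesRV ω, S.sideRV k i ω)) ≤
      entropy (S.lawGiven θ)
          (fun ω => (S.answersRV ω, S.queriesRV ω, S.sideRV k i ω)) -
        entropy (S.lawGiven θ) (fun ω => (S.queriesRV ω, S.sideRV k i ω)) := by
    intro n _
    have hq : ∀ ω ω' : S.Outcome, S.queriesRV ω = S.queriesRV ω' →
      S.queryRV n ω = S.queryRV n ω' := fun ω ω' hh => congrFun hh n
    refine le_trans ?_ (entropy_answerRV_sub_le hs hp θ k i n)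
    have e : ∀ θ, entropy (S.lawGiven θ)
          (fun ω => (S.answerRV n ω, S.queryRV n ω, S.sideRV k i ω)) =
        entropy (S.jointLaw p) (fun ω => (S.answerRV n ω, S.queryRV n ω, S.sideRV k i ω)) :=
      fun θ => hpr.entropy_lawGiven_comp_eq hp θ n
        (fun x => (x.2.1, x.1, (x.2.2.1 i, x.2.2.2 k)))
    have e' : ∀ θ, entropy (S.lawGiven θ)
          (fun ω => (S.queryRV n ω, S.sideRV k i ω)) =
        entropy (S.jointLaw p) (fun ω => (S.queryRV n ω, S.sideRV k i ω)) :=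
      fun θ => hpr.entropy_lawGiven_comp_eq hp θ n
        (fun x => (x.1, (x.2.2.1 i, x.2.2.2 k)))
    -- The change of demand: the conditional entropy of A_n given only Q_n and the side information
    -- involves database `n` alone, so privacy applies.
    rw [e θ, e' θ, ← e θ', ← e' θ']
    have := entropy_submodular (P := S.lawGiven θ')
      (X := fun ω => (S.answerRV n ω, S.queryRV n ω, S.sideRV k i ω))
      (Y := fun ω => (S.queriesRV ω, S.sideRV k i ω))
      (fun ω => (S.answerRV n ω, S.queriesRV ω, S.sideRV k i ω))
      (fun ω => (S.queryRV n ω, S.sideRV k i ω))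
      (fun ω _ ω' _ hh => by
        simp only [Prod.mk.injEq] at hh ⊢
        tauto)
      (fun ω _ ω' _ hh => (Prod.ext_iff.1 hh).2)
      (fun ω _ ω' _ hh => by
        simp only [Prod.mk.injEq] at hh ⊢
        exact ⟨hq _ _ hh.1, hh.2⟩)
    linarith
  have h4 := Finset.sum_le_sum h3
  rw [Finset.sum_const, Finset.card_univ, Fintype.card_fin, nsmul_eq_mul] at h4
  have h5 : entropy (S.lawGiven θ')
      (fun ω => (S.answersRV ω, S.queriesRV ω, S.sideRV k i ω)) =
    entropy (S.lawGiven θ')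
      (fun ω => ((fun n => S.answerRV n ω), S.queriesRV ω, S.sideRV k i ω)) := rfl
  linarith

end Constraints

/-! ### Counting cached bits, and the two converse lines. -/

section Values

variable {S}

/-- Number of bits of message `i` that user `k` stores. -/
def cachedBits (S : UncodedScheme K U N L) (k : Fin U) (i : Fin K) : ℕ :=
  ((S.cache k).filter fun b => b.1 = i).card

lemma entropy_cacheRV (θ : Demand K U) (k : Fin U) :
    entropy (S.lawGiven θ) (S.cacheRV k) = (S.cache k).card :=
  S.entropy_bitsRV θ (S.cache k)

lemma card_filter_fst_eq (i : Fin K) :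
    ((univ : Finset (Fin K × Fin L)).filter fun b => b.1 = i).card = L := by
  have : ((univ : Finset (Fin K × Fin L)).filter fun b => b.1 = i) = {i} ×ˢ univ := by
    ext ⟨j, l⟩
    simp [eq_comm]
  rw [this, Finset.card_product]
  simp

lemma entropy_sideRV (θ : Demand K U) (k : Fin U) (i : Fin K) :
    entropy (S.lawGiven θ) (S.sideRV k i) = L + (S.cache k).card - S.cachedBits k i := by
  classical
  have h : entropy (S.lawGiven θ) (S.sideRV k i) = entropy (S.lawGiven θ)
      (S.bitsRV ((univ.filter fun b => b.1 = i) ∪ S.cache k)) := by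
    refine Determines.entropy_eq (fun ω _ ω' _ hh => ?_) (fun ω _ ω' _ hh => ?_)
    · refine Prod.ext ?_ ?_
      · funext l
        exact congrFun hh ⟨(i, l), by simp⟩
      · funext ⟨b, hb⟩
        exact congrFun hh ⟨b, Finset.mem_union_right _ hb⟩
    · obtain ⟨h1, h2⟩ := Prod.ext_iff.1 hh
      funext ⟨⟨j, l⟩, hb⟩
      rcases Finset.mem_union.1 hb with hb | hb
      · obtain rfl : j = i := by simpa using hb
        exact congrFun h1 l
      · exact congrFun h2 ⟨(j, l), hb⟩
  rw [h, entropy_bitsRV]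
  have h2 := Finset.card_union_add_card_inter (univ.filter fun b => b.1 = i) (S.cache k)
  rw [card_filter_fst_eq, Finset.filter_inter, Finset.univ_inter] at h2
  rw [eq_sub_iff_add_eq]
  exact_mod_cast h2

end Values

section TwoMessages

variable {S : UncodedScheme 2 2 N L} {p : PMF (Demand 2 2)}

lemma card_cache_eq (k : Fin 2) {i j : Fin 2} (hij : i ≠ j) :
    (S.cache k).card = S.cachedBits k i + S.cachedBits k j := by
  rw [cachedBits, cachedBits, ← Finset.card_filter_add_card_filter_not (fun b => b.1 = i)]
  congr 2
  ext b
  simp only [Finset.mem_filter, and_congr_right_iff]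
  intro _
  omega

/-- Submodularity with `W_i` as common part; bits of message `j` cached by both users are counted
twice, hence only an inequality. -/
lemma entropy_sideRV_cacheRV_le (θ : Demand 2 2) (k k' : Fin 2) {i j : Fin 2} (hij : i ≠ j) :
    entropy (S.lawGiven θ) (fun ω => (S.sideRV k i ω, S.cacheRV k' ω)) ≤
      L + S.cachedBits k j + S.cachedBits k' j := by
  have h1 := entropy_submodular (P := S.lawGiven θ) (X := S.sideRV k i) (Y := S.sideRV k' i)
    (fun ω => (S.sideRV k i ω, S.cacheRV k' ω)) (S.messageRV i)
    (fun ω _ ω' _ hh => by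
      simp only [sideRV, Prod.mk.injEq] at hh ⊢
      tauto)
    (fun ω _ ω' _ hh => (Prod.ext_iff.1 hh).1) (fun ω _ ω' _ hh => (Prod.ext_iff.1 hh).1)
  have h2 : entropy (S.lawGiven θ) (S.messageRV i) = L := by
    have : entropy (S.lawGiven θ) (S.messageRV i) = entropy (S.lawGiven θ)
        (S.bitsRV (univ.filter fun b => b.1 = i)) := by
      refine Determines.entropy_eq (fun ω _ ω' _ hh => ?_) (fun ω _ ω' _ hh => ?_)
      · funext l
        exact congrFun hh ⟨(i, l), by simp⟩
      · funext ⟨⟨j, l⟩, hb⟩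
        obtain rfl : j = i := by simpa using hb
        exact congrFun hh l
    rw [this, entropy_bitsRV, card_filter_fst_eq]
  rw [entropy_sideRV, entropy_sideRV, card_cache_eq k hij, card_cache_eq k' hij, h2] at h1
  push_cast at h1
  linarith

lemma load_ge_of_two_users (hL : 0 < L) (hd : S.Decodable p) (hs : S.NoSideChannel p)
    (hpr : S.Private p) (hp : ∀ θ, p θ ≠ 0) {k k' i j : Fin 2} (hk : k ≠ k') (hij : i ≠ j) :
    2 * (L : ℝ) - S.cachedBits k i - S.cachedBits k j - S.cachedBits k' j ≤ S.load p * L := by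
  set θ : Demand 2 2 := fun m => if m = k then i else j
  have hθ : θ k = i := if_pos rfl
  have hθ' : θ k' = j := if_neg hk.symm
  have h1 := entropy_answersRV_le hpr hp hL θ
  have h2 := entropy_wanted_add_le hd hs hp θ k
  have h3 := entropy_le_of_second_user hd hs hp θ k k' (by rw [hθ, hθ']; omega)
  have h4 := entropy_sideRV_cacheRV_le (S := S) θ k k' hij
  rw [hθ] at h2 h3
  rw [entropy_messagesRV] at h3
  rw [entropy_sideRV, entropy_cacheRV] at h2
  push_cast at h3
  linarith

lemma load_ge_of_one_user (hN : 0 < N) (hL : 0 < L) (hd : S.Decodable p)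
    (hs : S.NoSideChannel p) (hpr : S.Private p) (hp : ∀ θ, p θ ≠ 0) (k : Fin 2) {i j : Fin 2}
    (hij : i ≠ j) :
    (L : ℝ) - S.cachedBits k i + (L - S.cachedBits k j) / N ≤ S.load p * L := by
  -- Both users want `i`, and the comparison demand has both wanting `j`.
  have h1 := entropy_answersRV_le hpr hp hL (fun _ => i)
  have h2 := entropy_wanted_add_le hd hs hp (fun _ => i) k
  have h3 := entropy_le_of_private hd hs hpr hp (fun _ => i) (fun _ => j) k (by omega)
  rw [entropy_messagesRV, entropy_sideRV, card_cache_eq k hij] at h3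
  rw [entropy_sideRV, entropy_cacheRV] at h2
  push_cast at h3
  have hN' : (0 : ℝ) < N := by exact_mod_cast hN
  have h4 := div_le_of_le_mul₀ hN'.le ?_ (h3.trans_eq (mul_comm _ _))
  · have h5 : (2 * (L : ℝ) - (L + (S.cachedBits k i + S.cachedBits k j) - S.cachedBits k i)) / N =
      (L - S.cachedBits k j) / N := by ring
    linarith
  · exact sub_nonneg.2 (Determines.entropy_le fun ω _ ω' _ hh => (Prod.ext_iff.1 hh).2)

/-- Averaging the two-user bound over the four choices of user and message counts each `cachedBits`
three times, whence the slope `3 / 2`. -/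
theorem load_ge_line_low (hL : 0 < L) (hd : S.Decodable p) (hs : S.NoSideChannel p)
    (hpr : S.Private p) (hp : ∀ θ, p θ ≠ 0) {M : ℝ}
    (hM : ∀ k, ((S.cache k).card : ℝ) ≤ M * L) : 2 - 3 / 2 * M ≤ S.load p := by
  have hL' : (0 : ℝ) < L := by exact_mod_cast hL
  have h01 : (0 : Fin 2) ≠ 1 := by decide
  have h1 := load_ge_of_two_users hL hd hs hpr hp h01 h01
  have h2 := load_ge_of_two_users hL hd hs hpr hp h01 h01.symm
  have h3 := load_ge_of_two_users hL hd hs hpr hp h01.symm h01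
  have h4 := load_ge_of_two_users hL hd hs hpr hp h01.symm h01.symm
  have c0 := hM 0
  have c1 := hM 1
  rw [card_cache_eq _ h01] at c0 c1
  push_cast at c0 c1
  refine le_of_mul_le_mul_right ?_ hL'
  linarith

/-- Averaging the one-user bound over the two messages leaves only the total cache size of user 0.
-/
theorem load_ge_line_high (hN : 0 < N) (hL : 0 < L) (hd : S.Decodable p)
    (hs : S.NoSideChannel p) (hpr : S.Private p) (hp : ∀ θ, p θ ≠ 0) {M : ℝ}
    (hM : ∀ k, ((S.cache k).card : ℝ) ≤ M * L) :
    ((N : ℝ) + 1) * (2 - M) / (2 * N) ≤ S.load p := by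
  have hL' : (0 : ℝ) < L := by exact_mod_cast hL
  have hN' : (0 : ℝ) < N := by exact_mod_cast hN
  have h01 : (0 : Fin 2) ≠ 1 := by decide
  have h1 := load_ge_of_one_user hN hL hd hs hpr hp 0 h01
  have h2 := load_ge_of_one_user hN hL hd hs hpr hp 0 h01.symm
  have c0 := hM 0
  rw [card_cache_eq _ h01] at c0
  push_cast at c0
  refine le_of_mul_le_mul_right ?_ hL'
  have h3 : ((N : ℝ) + 1) * (2 - M) / (2 * N) * L = (2 * L - M * L) * (1 + 1 / N) / 2 := by
    field_simp
  have h4 : (2 * L - M * L) * (1 + 1 / (N : ℝ)) ≤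
      (2 * L - (S.cachedBits 0 0 + S.cachedBits 0 1)) * (1 + 1 / (N : ℝ)) :=
    mul_le_mul_of_nonneg_right (by linarith) (by positivity)
  have h5 : (2 * L - ((S.cachedBits 0 0 : ℝ) + S.cachedBits 0 1)) * (1 + 1 / (N : ℝ)) =
      ((L : ℝ) - S.cachedBits 0 0 + (L - S.cachedBits 0 1) / N) +
      ((L : ℝ) - S.cachedBits 0 1 + (L - S.cachedBits 0 0) / N) := by
    ring
  linarith

end TwoMessages

end UncodedScheme

end

end MuPIR

/-! ### The masked multicast scheme. -/

namespace MuPIR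

noncomputable section

lemma map_uniformOfFintype_equiv {α β : Type} [Fintype α] [Nonempty α] [Fintype β] [Nonempty β]
    (e : α ≃ β) : (PMF.uniformOfFintype α).map e = PMF.uniformOfFintype β := by
  classical
  ext b
  rw [PMF.map_apply, tsum_eq_single (e.symm b)]
  · simp [Fintype.card_congr e]
  · intro a ha
    rw [if_neg]
    rintro rfl
    simp at ha

/-- Positions in a message: `b`-bit blocks, namely an uncached one (`none`) and `m` blocks owned by
each of the two users, then `a₀` bits that nobody caches and `a₁` bits that both users cache. -/
abbrev Position (m b a₀ a₁ : ℕ) : Type :=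
  (Option (Fin 2 × Fin m) × Fin b) ⊕ (Fin a₀ ⊕ Fin a₁)

/-- Coefficients for the cached blocks, by message, owner and index of the block. -/
abbrev Coeff (m : ℕ) : Type := Fin 2 × (Fin 2 × Fin m) → Bool

section Construction

variable {m b a₀ a₁ L : ℕ}

/-- The positions that user `k` caches. -/
def cachedPositions (m b a₀ a₁ : ℕ) (k : Fin 2) : Finset (Position m b a₀ a₁) :=
  (((univ : Finset (Fin m)).map
    ⟨fun j => some (k, j), fun j j' h => by simpa using h⟩) ×ˢ univ).disjSum
      ((∅ : Finset (Fin a₀)).disjSum univ)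

lemma card_cachedPositions (k : Fin 2) : (cachedPositions m b a₀ a₁ k).card = m * b + a₁ := by
  simp [cachedPositions, Finset.card_disjSum, Finset.card_product]

/-- Linear combination of the blocks of message `i`, in which the uncached block has
coefficient `1`. -/
def blockSum (e : Fin L ≃ Position m b a₀ a₁) (q : Coeff m) (W : Messages 2 L) (i : Fin 2)
    (t : Fin b) : Bool :=
  W i (e.symm (Sum.inl (none, t))) + ∑ x, q (i, x) * W i (e.symm (Sum.inl (some x, t)))

/-- The blocks in the `j`-th multicast message: for each user a wanted block that the other user
owns. -/
def multicast (θ : Demand 2 2) (j : Fin m) : Coeff m :=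
  Pi.single (θ 0, (1, j)) 1 + Pi.single (θ 1, (0, j)) 1

/-- The first database gets a random `f`; the others get `f` shifted by a multicast pattern. -/
def queryVector (θ : Demand 2 2) (f : Coeff m) : Fin (m + 1) → Coeff m :=
  Fin.cons f fun j => f + multicast θ j

/-- The scheme in which the other databases send multicast messages, masked by two linear
combinations that the first database sends. -/
def maskedMulticast (e : Fin L ≃ Position m b a₀ a₁) : UncodedScheme 2 2 (m + 1) L where
  cache k := univ ×ˢ (cachedPositions m b a₀ a₁ k).map e.symm.toEmbedding
  Query _ := Coeff m
  Answer _ := (Fin 2 × Fin b) ⊕ (Fin 2 × Fin a₀) → Bool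
  queryLaw θ _ := (PMF.uniformOfFintype (Coeff m)).map (queryVector θ)
  answer n q W :=
    if n = 0 then
      Sum.elim (fun x => blockSum e q W x.1 x.2) (fun x => W x.1 (e.symm (Sum.inr (Sum.inl x.2))))
    else
      Sum.elim (fun x => if x.1 = 0 then ∑ i, blockSum e q W i x.2 else 0) (fun _ => 0)

variable (e : Fin L ≃ Position m b a₀ a₁)

lemma sum_single_mul {ι : Type} [Fintype ι] [DecidableEq ι] (a : ι) (w : ι → Bool) :
    ∑ x, (Pi.single a 1 : ι → Bool) x * w x = w a := by
  rw [Finset.sum_eq_single a]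
  · simp
  · intro x _ hx
    simp [hx]
  · simp

/-- Over `Bool`, where addition is exclusive or, block sums are affine in the coefficients, so the
shift contributes exactly the two selected blocks. -/
lemma sum_blockSum_add_multicast (θ : Demand 2 2) (f : Coeff m) (W : Messages 2 L) (j : Fin m)
    (t : Fin b) :
    ∑ i, blockSum e (f + multicast θ j) W i t = ∑ i, blockSum e f W i t +
      (W (θ 0) (e.symm (Sum.inl (some (1, j), t))) +
        W (θ 1) (e.symm (Sum.inl (some (0, j), t)))) := by
  have h : ∀ a : Fin 2 × (Fin 2 × Fin m), ∑ i, ∑ x, (Pi.single a 1 : Coeff m) (i, x) *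
      W i (e.symm (Sum.inl (some x, t))) = W a.1 (e.symm (Sum.inl (some a.2, t))) := by
    intro a
    rw [← Fintype.sum_prod_type (f := fun y : Fin 2 × (Fin 2 × Fin m) =>
      (Pi.single a 1 : Coeff m) y * W y.1 (e.symm (Sum.inl (some y.2, t))))]
    exact sum_single_mul a _
  simp only [blockSum, multicast, Pi.add_apply, add_mul, Finset.sum_add_distrib, h, add_assoc]

lemma card_cache_maskedMulticast (k : Fin 2) :
    ((maskedMulticast e).cache k).card = 2 * (m * b + a₁) := by
  simp [maskedMulticast, Finset.card_product, card_cachedPositions]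

lemma exists_of_mem_support_lawGiven {θ : Demand 2 2} {ω : (maskedMulticast e).Outcome}
    (hω : ω ∈ ((maskedMulticast e).lawGiven θ).support) :
    ∃ W f, ω = (θ, W, queryVector θ f) := by
  simp only [UncodedScheme.lawGiven, PMF.mem_support_bind_iff, PMF.mem_support_map_iff] at hω
  obtain ⟨W, -, q, hq, rfl⟩ := hω
  obtain ⟨f, -, rfl⟩ := (PMF.mem_support_map_iff (queryVector θ)
    (PMF.uniformOfFintype (Coeff m)) q).1 hq
  exact ⟨W, f, rfl⟩

lemma message_eq_of_answers_eq {θ : Demand 2 2} {f : Coeff m} {W W' : Messages 2 L}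
    (k : Fin 2)
    (hA : ∀ n, (maskedMulticast e).answer n (queryVector θ f n) W =
      (maskedMulticast e).answer n (queryVector θ f n) W')
    (hZ : (maskedMulticast e).cacheContent W k = (maskedMulticast e).cacheContent W' k) :
    W (θ k) = W' (θ k) := by
  have hcache : ∀ i, ∀ x ∈ cachedPositions m b a₀ a₁ k, W i (e.symm x) = W' i (e.symm x) := by
    intro i x hx
    exact congrFun hZ ⟨(i, e.symm x), Finset.mem_product.2
      ⟨Finset.mem_univ _, Finset.mem_map_of_mem _ hx⟩⟩
  have hown : ∀ i j t, W i (e.symm (Sum.inl (some (k, j), t))) =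
      W' i (e.symm (Sum.inl (some (k, j), t))) := fun i j t =>
    hcache i _ (by simpa [cachedPositions] using ⟨j, rfl⟩)
  have hboth : ∀ i a, W i (e.symm (Sum.inr (Sum.inr a))) =
      W' i (e.symm (Sum.inr (Sum.inr a))) := fun i a =>
    hcache i _ (by simp [cachedPositions])
  have h0 := hA 0
  simp only [maskedMulticast, queryVector, Fin.cons_zero, if_true] at h0
  have hblock : ∀ i t, blockSum e f W i t = blockSum e f W' i t := fun i t =>
    congrFun h0 (Sum.inl (i, t))
  have hplain : ∀ i a, W i (e.symm (Sum.inr (Sum.inl a))) =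
      W' i (e.symm (Sum.inr (Sum.inl a))) := fun i a => congrFun h0 (Sum.inr (i, a))
  -- The mask is the sum of the two combinations sent by database 0. Cancelling it exposes two
  -- blocks, one of them cached by user `k`.
  have hmulti : ∀ j t, W (θ 0) (e.symm (Sum.inl (some (1, j), t))) +
        W (θ 1) (e.symm (Sum.inl (some (0, j), t))) =
      W' (θ 0) (e.symm (Sum.inl (some (1, j), t))) +
        W' (θ 1) (e.symm (Sum.inl (some (0, j), t))) := by
    intro j t
    have h1 := congrFun (hA j.succ) (Sum.inl (0, t))
    simp only [maskedMulticast, queryVector, Fin.cons_succ, Fin.succ_ne_zero, if_false,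
      Sum.elim_inl, if_true, sum_blockSum_add_multicast] at h1
    simpa only [hblock, add_right_inj] using h1
  have hsome : ∀ x t, W (θ k) (e.symm (Sum.inl (some x, t))) =
      W' (θ k) (e.symm (Sum.inl (some x, t))) := by
    rintro ⟨k', j⟩ t
    by_cases hk : k' = k
    · rw [hk, hown]
    have hm := hmulti j t
    obtain ⟨rfl, rfl⟩ | ⟨rfl, rfl⟩ : k = 0 ∧ k' = 1 ∨ k = 1 ∧ k' = 0 := by omega
    · rwa [hown (θ 1), add_left_inj] at hm
    · rwa [hown (θ 0), add_right_inj] at hm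
  have hnone : ∀ t, W (θ k) (e.symm (Sum.inl (none, t))) =
      W' (θ k) (e.symm (Sum.inl (none, t))) := by
    intro t
    have h1 := hblock (θ k) t
    simpa only [blockSum, hsome, add_left_inj] using h1
  funext l
  obtain ⟨x, rfl⟩ := e.symm.surjective l
  rcases x with ⟨_ | x, t⟩ | a | a
  · exact hnone t
  · exact hsome x t
  · exact hplain _ a
  · exact hboth _ a

lemma decodable_maskedMulticast (p : PMF (Demand 2 2)) : (maskedMulticast e).Decodable p := by
  intro k
  rw [condEntropy, sub_eq_zero]
  refine Determines.entropy_prod_eq fun ω hω ω' hω' hh => ?_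
  rw [UncodedScheme.jointLaw_eq_bind, PMF.mem_support_bind_iff] at hω hω'
  obtain ⟨θ, -, hω⟩ := hω
  obtain ⟨θ', -, hω'⟩ := hω'
  obtain ⟨W, f, rfl⟩ := exists_of_mem_support_lawGiven e hω
  obtain ⟨W', f', rfl⟩ := exists_of_mem_support_lawGiven e hω'
  simp only [Prod.mk.injEq] at hh
  obtain ⟨h1, h2, h3, h4⟩ := hh
  obtain rfl : θ = θ' := h1
  obtain rfl : f = f' := congrFun h2 0
  exact message_eq_of_answers_eq e k (fun n => congrFun h3 n) h4

/-- Translation by the multicast pattern permutes the coefficient vectors, so each query alone is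
uniform whatever the demand. -/
lemma map_queryVector_apply (θ : Demand 2 2) (n : Fin (m + 1)) :
    (PMF.uniformOfFintype (Coeff m)).map (fun f => queryVector θ f n) =
      PMF.uniformOfFintype (Coeff m) := by
  refine Fin.cases ?_ (fun j => ?_) n
  · exact PMF.map_id _
  · exact map_uniformOfFintype_equiv (Equiv.addRight (multicast θ j))

lemma private_maskedMulticast (p : PMF (Demand 2 2)) : (maskedMulticast e).Private p := by
  intro n
  set S := maskedMulticast e
  set Y : S.Outcome → _ :=
    fun ω => (S.queryRV n ω, S.answerRV n ω, S.messagesRV ω, S.cachesRV ω) with hY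
  set μ := (PMF.uniformOfFintype (Messages 2 L)).bind fun W =>
    (PMF.uniformOfFintype (Coeff m)).map fun q : S.Query n =>
      (q, S.answer n q W, W, S.cacheContent W) with hμ
  have hmap : ∀ θ, (S.lawGiven θ).map Y = μ := by
    intro θ
    rw [UncodedScheme.lawGiven, PMF.map_bind, hμ]
    congr 1
    funext W
    refine (PMF.map_comp _ _ _).trans ((PMF.map_comp _ _ _).trans ?_)
    exact ((congrArg (PMF.map fun q : S.Query n => (q, S.answer n q W, W, S.cacheContent W))
      (map_queryVector_apply θ n)).symm.trans (PMF.map_comp _ _ _)).symm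
  have hjoint : (S.jointLaw p).map Y = μ := by
    rw [UncodedScheme.jointLaw_eq_bind, PMF.map_bind]
    simp only [hmap, PMF.bind_const]
  have hE : ∀ θ, entropy (S.lawGiven θ) Y = entropy (S.jointLaw p) Y := fun θ => by
    rw [entropy, entropy, hmap, hjoint]
  have h1 := entropy_bind_of_const p S.lawGiven S.demandRV Y
    (fun _ _ h => S.demandRV_of_mem_support h) hE
  have h2 := entropy_bind_index p S.lawGiven S.demandRV
    (fun _ _ h => S.demandRV_of_mem_support h)
  rw [mutualInfo, condEntropy, UncodedScheme.jointLaw_eq_bind, h2, h1,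
    UncodedScheme.jointLaw_eq_bind]
  ring

lemma entropy_comp_messagesRV_maskedMulticast (θ : Demand 2 2) {α : Type} [Fintype α]
    (g : Messages 2 L → α) :
    entropy ((maskedMulticast e).lawGiven θ) (fun ω => g ((maskedMulticast e).messagesRV ω)) =
      entropy (PMF.uniformOfFintype (Messages 2 L)) g := by
  refine entropy_congr_comp (Y := id) (fun W => ?_) g
  rw [prob, prob, UncodedScheme.map_messagesRV_lawGiven, PMF.map_id]

lemma entropy_queriesRV_prod_maskedMulticast (θ : Demand 2 2) {α : Type} [Fintype α]
    (g : Messages 2 L → α) :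
    entropy ((maskedMulticast e).lawGiven θ)
        (fun ω => ((maskedMulticast e).queriesRV ω, g ((maskedMulticast e).messagesRV ω))) =
      entropy (PMF.uniformOfFintype (Coeff m)) id +
        entropy (PMF.uniformOfFintype (Messages 2 L)) g := by
  set S := maskedMulticast e with hS
  have h1 : entropy (S.lawGiven θ) (fun ω => (S.queriesRV ω, g (S.messagesRV ω))) =
      entropy (S.lawGiven θ) (fun ω => (S.queryRV 0 ω, g (S.messagesRV ω))) := by
    refine Determines.entropy_eq (fun ω hω ω' hω' hh => ?_) (fun ω _ ω' _ hh => ?_)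
    · obtain ⟨W, f, rfl⟩ := exists_of_mem_support_lawGiven e hω
      obtain ⟨W', f', rfl⟩ := exists_of_mem_support_lawGiven e hω'
      simp only [Prod.mk.injEq] at hh ⊢
      obtain rfl : f = f' := hh.1
      exact ⟨rfl, hh.2⟩
    · simp only [Prod.mk.injEq] at hh ⊢
      exact ⟨congrFun hh.1 0, hh.2⟩
  -- The query law ignores the caches, so `f` can be drawn before the messages and serve as the
  -- index of a mixture.
  have h2 : S.lawGiven θ = (PMF.uniformOfFintype (Coeff m)).bind fun f =>
      (PMF.uniformOfFintype (Messages 2 L)).map fun W => (θ, W, queryVector θ f) := by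
    have : S.lawGiven θ = (PMF.uniformOfFintype (Messages 2 L)).bind fun W =>
        (PMF.uniformOfFintype (Coeff m)).bind fun f => PMF.pure (θ, W, queryVector θ f) := by
      rw [UncodedScheme.lawGiven]
      congr 1
      funext W
      exact PMF.map_comp _ _ _
    rw [this, PMF.bind_comm]
    rfl
  rw [h1, h2]
  refine entropy_bind_of_const _ _ (S.queryRV 0) _ (fun f ω hω => ?_) fun f => ?_
  · obtain ⟨W, -, rfl⟩ := (PMF.mem_support_map_iff _ _ _).1 hω
    rfl
  · refine entropy_congr_comp (Y := id) (fun W => ?_) g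
    exact congrArg (fun μ : PMF (Messages 2 L) => (μ W).toReal) (PMF.map_comp _ _ _)

lemma noSideChannel_maskedMulticast (p : PMF (Demand 2 2)) :
    (maskedMulticast e).NoSideChannel p := by
  intro k
  set S := maskedMulticast e with hS
  have e1 : entropy (S.jointLaw p) (fun ω => (S.queriesRV ω, (S.demandRV ω, S.cacheRV k ω))) =
      entropy (S.jointLaw p) (fun ω => (S.demandRV ω, (S.queriesRV ω, S.cacheRV k ω))) := by
    refine Determines.entropy_eq (fun ω _ ω' _ hh => ?_) (fun ω _ ω' _ hh => ?_) <;>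
    · simp only [Prod.mk.injEq] at hh ⊢
      tauto
  have e2 : entropy (S.jointLaw p)
        (fun ω => (S.queriesRV ω, (S.messagesRV ω, (S.demandRV ω, S.cacheRV k ω)))) =
      entropy (S.jointLaw p) (fun ω => (S.demandRV ω,
        (S.queriesRV ω, (S.messagesRV ω, S.cacheRV k ω)))) := by
    refine Determines.entropy_eq (fun ω _ ω' _ hh => ?_) (fun ω _ ω' _ hh => ?_) <;>
    · simp only [Prod.mk.injEq] at hh ⊢
      tauto
  have e3 : entropy (S.jointLaw p) (fun ω => (S.messagesRV ω, (S.demandRV ω, S.cacheRV k ω))) =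
      entropy (S.jointLaw p) (fun ω => (S.demandRV ω, (S.messagesRV ω, S.cacheRV k ω))) := by
    refine Determines.entropy_eq (fun ω _ ω' _ hh => ?_) (fun ω _ ω' _ hh => ?_) <;>
    · simp only [Prod.mk.injEq] at hh ⊢
      tauto
  have f1 := fun θ => entropy_queriesRV_prod_maskedMulticast e θ (fun W => S.cacheContent W k)
  have f2 := fun θ => entropy_queriesRV_prod_maskedMulticast e θ
    (fun W => (W, S.cacheContent W k))
  have f3 := fun θ => entropy_comp_messagesRV_maskedMulticast e θ (fun W => S.cacheContent W k)
  have f4 := fun θ => entropy_comp_messagesRV_maskedMulticast e θ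
    (fun W => (W, S.cacheContent W k))
  have hd : ∀ t, ∀ ω ∈ (S.lawGiven t).support, S.demandRV ω = t :=
    fun _ _ h => S.demandRV_of_mem_support h
  have g1 := entropy_bind_of_const p S.lawGiven S.demandRV _ hd f1
  have g2 := entropy_bind_of_const p S.lawGiven S.demandRV _ hd f2
  have g3 := entropy_bind_of_const p S.lawGiven S.demandRV _ hd f3
  have g4 := entropy_bind_of_const p S.lawGiven S.demandRV _ hd f4
  rw [condMutualInfo, condEntropy, condEntropy, e1, e2, e3]
  change entropy (p.bind S.lawGiven) (fun ω => (S.demandRV ω,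
      (S.queriesRV ω, S.cacheContent (S.messagesRV ω) k))) -
    entropy (p.bind S.lawGiven) (fun ω => (S.demandRV ω, S.cacheContent (S.messagesRV ω) k)) -
    (entropy (p.bind S.lawGiven) (fun ω => (S.demandRV ω,
      (S.queriesRV ω, (S.messagesRV ω, S.cacheContent (S.messagesRV ω) k)))) -
    entropy (p.bind S.lawGiven) (fun ω => (S.demandRV ω,
      (S.messagesRV ω, S.cacheContent (S.messagesRV ω) k)))) = 0
  rw [g1, g2, g3, g4]
  ring

lemma maskedMulticast_answer_succ (j : Fin m) (q : Coeff m) (W : Messages 2 L) :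
    (maskedMulticast e).answer j.succ q W =
      Sum.elim (fun x => if x.1 = 0 then ∑ i, blockSum e q W i x.2 else 0) (fun _ => 0) := by
  simp only [maskedMulticast, if_neg (Fin.succ_ne_zero j)]

lemma load_maskedMulticast_le (p : PMF (Demand 2 2)) :
    (maskedMulticast e).load p ≤ ((m + 2) * b + 2 * a₀ : ℝ) / L := by
  set S := maskedMulticast e with hS
  refine div_le_div_of_nonneg_right ?_ (Nat.cast_nonneg L)
  rw [Fin.sum_univ_succ]
  have h0 : entropy (S.jointLaw p) (S.answerRV 0) ≤ 2 * b + 2 * a₀ := by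
    refine (entropy_bits_le (ι := (Fin 2 × Fin b) ⊕ (Fin 2 × Fin a₀)) _ _).trans_eq ?_
    simp
  -- All answers share one alphabet, but outside database 0 only `b` coordinates can be nonzero.
  have h1 : ∀ j ∈ (univ : Finset (Fin m)),
      entropy (S.jointLaw p) (S.answerRV j.succ) ≤ b := by
    intro j _
    refine le_trans (Determines.entropy_le
      (Y := fun ω (t : Fin b) => (S.answerRV j.succ ω : _ → Bool) (Sum.inl (0, t)))
      fun ω _ ω' _ hh => ?_) ((entropy_bits_le _ _).trans_eq (by simp))
    have hA : ∀ ω, S.answerRV j.succ ω = Sum.elim (fun x => if x.1 = 0 then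
        ∑ i, blockSum e (S.queryRV j.succ ω) (S.messagesRV ω) i x.2 else 0) (fun _ => 0) :=
      fun ω => maskedMulticast_answer_succ e j _ _
    have hB : ∀ t, ∑ i, blockSum e (S.queryRV j.succ ω) (S.messagesRV ω) i t =
        ∑ i, blockSum e (S.queryRV j.succ ω') (S.messagesRV ω') i t := by
      intro t
      have := congrFun hh t
      simpa only [hA, Sum.elim_inl, if_true] using this
    rw [hA, hA]
    simp only [hB]
    rfl
  have h2 := Finset.sum_le_sum h1
  rw [Finset.sum_const, Finset.card_univ, Fintype.card_fin, nsmul_eq_mul] at h2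
  linarith

end Construction

lemma exists_scheme_of_blocks (m b a₀ a₁ : ℕ) (p : PMF (Demand 2 2)) :
    ∃ S : UncodedScheme 2 2 (m + 1) ((2 * m + 1) * b + a₀ + a₁),
      (∀ k, (S.cache k).card = 2 * (m * b + a₁)) ∧ S.NoSideChannel p ∧ S.Decodable p ∧
      S.Private p ∧
      S.load p ≤ ((m + 2) * b + 2 * a₀ : ℝ) / (((2 * m + 1) * b + a₀ + a₁ : ℕ) : ℝ) := by
  have e : Fin ((2 * m + 1) * b + a₀ + a₁) ≃ Position m b a₀ a₁ :=
    Fintype.equivOfCardEq (by simp; ring)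
  exact ⟨maskedMulticast e, card_cache_maskedMulticast e, noSideChannel_maskedMulticast e p,
    decodable_maskedMulticast e p, private_maskedMulticast e p, load_maskedMulticast_le e p⟩

end

end MuPIR

/-! ### Matching the bounds, and passing from rational to real memory. -/

namespace MuPIR

noncomputable section

lemma achievableUncodedLoads_mono {K U N : ℕ} {p : PMF (Demand K U)} {M M' : ℝ} (h : M ≤ M') :
    achievableUncodedLoads K U N p M ⊆ achievableUncodedLoads K U N p M' := by
  rintro R ⟨L, hL, S, hS, hrest⟩
  exact ⟨L, hL, S, fun k => (hS k).trans (mul_le_mul_of_nonneg_right h (Nat.cast_nonneg L)), hrest⟩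

/-- The claimed optimal load, as the maximum of its two affine pieces. -/
def optimalLoad (N : ℕ) (M : ℝ) : ℝ :=
  max (2 - 3 / 2 * M) (((N : ℝ) + 1) * (2 - M) / (2 * N))

variable {N : ℕ} {p : PMF (Demand 2 2)} {M : ℝ}

lemma optimalLoad_eq_low (hN : 0 < N) (h : M * (2 * N - 1) ≤ 2 * (N - 1)) :
    optimalLoad N M = 2 - 3 / 2 * M := by
  have hN' : (0 : ℝ) < N := by exact_mod_cast hN
  refine max_eq_left ?_
  rw [div_le_iff₀ (by positivity)]
  linarith

lemma optimalLoad_eq_high (hN : 0 < N) (h : 2 * (N - 1) ≤ M * (2 * N - 1)) :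
    optimalLoad N M = ((N : ℝ) + 1) * (2 - M) / (2 * N) := by
  have hN' : (0 : ℝ) < N := by exact_mod_cast hN
  refine max_eq_right ?_
  rw [le_div_iff₀ (by positivity)]
  linarith

lemma optimalLoad_mem_lowerBounds (hN : 0 < N) (hp : ∀ θ, p θ ≠ 0) :
    optimalLoad N M ∈ lowerBounds (achievableUncodedLoads 2 2 N p M) := by
  rintro R ⟨L, hL, S, hM, hs, hd, hpr, rfl⟩
  exact max_le (UncodedScheme.load_ge_line_low hL hd hs hpr hp hM)
    (UncodedScheme.load_ge_line_high hN hL hd hs hpr hp hM)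

lemma exists_achievable_le_low {m s t : ℕ} (hm : 0 < m) (ht : 0 < t)
    (h : (2 * m + 1) * s ≤ 2 * m * t) :
    ∃ R ∈ achievableUncodedLoads 2 2 (m + 1) p ((s : ℝ) / t),
      R ≤ 2 - 3 / 2 * ((s : ℝ) / t) := by
  obtain ⟨a, ha⟩ := Nat.exists_eq_add_of_le h
  -- Blocks of `s` bits padded with uncached bits to length `2mt`: each cache holds `2ms` bits, a
  -- ratio of `s / t`.
  obtain ⟨S, hc, hs, hd, hpr, hload⟩ := exists_scheme_of_blocks m s a 0 p
  have hL : (2 * m + 1) * s + a + 0 = 2 * m * t := by rw [add_zero, ha]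
  have hLr : (((2 * m + 1) * s + a + 0 : ℕ) : ℝ) = 2 * m * t := by rw [hL]; push_cast; ring
  have ha' : (a : ℝ) = 2 * m * t - (2 * m + 1) * s := by
    rw [eq_sub_iff_add_eq']
    exact_mod_cast ha.symm
  have hm' : (0 : ℝ) < m := by exact_mod_cast hm
  have ht' : (0 : ℝ) < t := by exact_mod_cast ht
  refine ⟨_, ⟨_, by rw [hL]; positivity, S, fun k => ?_, hs, hd, hpr, rfl⟩, hload.trans_eq ?_⟩
  · rw [hc, hLr]
    refine le_of_eq ?_
    push_cast
    field_simp
    ring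
  · rw [hLr, ha']
    field_simp
    ring

lemma exists_achievable_le_high {m s t : ℕ} (ht : 0 < t) (hst : s ≤ 2 * t)
    (h : 2 * m * t ≤ (2 * m + 1) * s) :
    ∃ R ∈ achievableUncodedLoads 2 2 (m + 1) p ((s : ℝ) / t),
      R ≤ (((m + 1 : ℕ) : ℝ) + 1) * (2 - (s : ℝ) / t) / (2 * ((m + 1 : ℕ) : ℝ)) := by
  obtain ⟨b, hb⟩ := Nat.exists_eq_add_of_le hst
  have h' : (2 * m + 1) * b ≤ 2 * (m + 1) * t := by nlinarith
  obtain ⟨a, ha⟩ := Nat.exists_eq_add_of_le h'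
  -- Blocks of `b = 2t - s` bits padded with bits cached by both users to length `2(m+1)t`: each
  -- cache holds `2(m+1)s` bits.
  obtain ⟨S, hc, hs, hd, hpr, hload⟩ := exists_scheme_of_blocks m b 0 a p
  have hL : (2 * m + 1) * b + 0 + a = 2 * (m + 1) * t := by rw [add_zero, ha]
  have hLr : (((2 * m + 1) * b + 0 + a : ℕ) : ℝ) = 2 * (m + 1) * t := by
    rw [hL]; push_cast; ring
  have hb' : (b : ℝ) = 2 * t - s := by
    rw [eq_sub_iff_add_eq']
    exact_mod_cast hb.symm
  have ha' : (a : ℝ) = 2 * (m + 1) * t - (2 * m + 1) * b := by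
    rw [eq_sub_iff_add_eq']
    exact_mod_cast ha.symm
  have hm' : (0 : ℝ) < m + 1 := by positivity
  have ht' : (0 : ℝ) < t := by exact_mod_cast ht
  refine ⟨_, ⟨_, by rw [hL]; positivity, S, fun k => ?_, hs, hd, hpr, rfl⟩, hload.trans_eq ?_⟩
  · rw [hc, hLr]
    refine le_of_eq ?_
    push_cast
    rw [ha', hb']
    field_simp
    ring
  · rw [hLr, hb']
    push_cast
    field_simp
    ring

lemma optimalLoad_mem_of_rat (hN : 2 ≤ N) (hp : ∀ θ, p θ ≠ 0) (r : ℚ) (h0 : 0 ≤ r)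
    (h2 : r ≤ 2) : optimalLoad N r ∈ achievableUncodedLoads 2 2 N p r := by
  obtain ⟨m, rfl⟩ : ∃ m, N = m + 1 := ⟨N - 1, by omega⟩
  -- An upper bound on the load suffices: the converse turns it into equality, so no answer entropy
  -- need be computed exactly.
  suffices h : ∃ R ∈ achievableUncodedLoads 2 2 (m + 1) p r, R ≤ optimalLoad (m + 1) r by
    obtain ⟨R, hR, hle⟩ := h
    rwa [← hle.antisymm (optimalLoad_mem_lowerBounds (Nat.succ_pos m) hp hR)]
  have ht : 0 < r.den := r.den_pos
  obtain ⟨s, hs⟩ : ∃ s : ℕ, r.num = s := Int.eq_ofNat_of_zero_le (Rat.num_nonneg.2 h0)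
  have hr : (r : ℝ) = (s : ℝ) / r.den := by
    rw [Rat.cast_def, hs]
    simp
  have ht' : (0 : ℝ) < r.den := by exact_mod_cast ht
  have h2' : s ≤ 2 * r.den := by
    have : (r : ℝ) ≤ 2 := by exact_mod_cast h2
    rw [hr, div_le_iff₀ ht'] at this
    exact_mod_cast this
  rw [hr]
  rcases le_total ((2 * m + 1) * s) (2 * m * r.den) with h | h
  · obtain ⟨R, hR, hle⟩ := exists_achievable_le_low (p := p) (by omega : 0 < m) ht h
    exact ⟨R, hR, hle.trans (le_max_left _ _)⟩
  · obtain ⟨R, hR, hle⟩ := exists_achievable_le_high (p := p) ht h2' h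
    exact ⟨R, hR, hle.trans (le_max_right _ _)⟩

lemma optimalLoad_sub_le (hN : 0 < N) {ε : ℝ} (hε : 0 ≤ ε) {r : ℝ} (h : M - ε ≤ r) :
    optimalLoad N r ≤ optimalLoad N M + 3 / 2 * ε := by
  have hN' : (1 : ℝ) ≤ N := by exact_mod_cast hN
  refine max_le ?_ ?_
  · have := le_max_left (2 - 3 / 2 * M) (((N : ℝ) + 1) * (2 - M) / (2 * N))
    rw [optimalLoad]
    linarith
  · have h1 := le_max_right (2 - 3 / 2 * M) (((N : ℝ) + 1) * (2 - M) / (2 * N))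
    have h2 : ((N : ℝ) + 1) * (2 - r) / (2 * N) ≤
        ((N : ℝ) + 1) * (2 - M) / (2 * N) + 3 / 2 * ε := by
      rw [div_add' _ _ _ (by positivity)]
      refine div_le_div_of_nonneg_right ?_ (by positivity)
      nlinarith
    rw [optimalLoad]
    linarith

lemma isGLB_optimalLoad (hN : 2 ≤ N) (hp : ∀ θ, p θ ≠ 0) (hM0 : 0 ≤ M) (hM2 : M ≤ 2) :
    IsGLB (achievableUncodedLoads 2 2 N p M) (optimalLoad N M) := by
  refine ⟨optimalLoad_mem_lowerBounds (by omega) hp, fun c hc => ?_⟩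
  have key : ∀ r : ℚ, 0 ≤ r → (r : ℝ) ≤ M → c ≤ optimalLoad N r := fun r hr hrM =>
    hc (achievableUncodedLoads_mono hrM (optimalLoad_mem_of_rat hN hp r hr
      (by exact_mod_cast hrM.trans hM2)))
  -- At zero there is no admissible rational strictly below `M`, but `M` itself is rational.
  rcases hM0.eq_or_lt with rfl | hM
  · simpa using key 0 le_rfl (by simp)
  refine le_of_forall_pos_le_add fun ε hε => ?_
  obtain ⟨r, hr, hrM⟩ := exists_rat_btwn (max_lt hM (by linarith : M - 2 / 3 * ε < M))
  have h1 := key r (by exact_mod_cast (le_max_left _ _).trans hr.le) hrM.le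
  have h2 := optimalLoad_sub_le (N := N) (by omega) (by positivity : 0 ≤ 2 / 3 * ε)
    ((le_max_right _ _).trans hr.le)
  linarith

lemma optimalUncodedLoad_eq (hN : 2 ≤ N) (hp : ∀ θ, p θ ≠ 0) (hM0 : 0 ≤ M) (hM2 : M ≤ 2) :
    optimalUncodedLoad 2 2 N p M = optimalLoad N M :=
  (isGLB_optimalLoad hN hp hM0 hM2).csInf_eq
    ⟨_, achievableUncodedLoads_mono (by simpa using hM0)
      (optimalLoad_mem_of_rat hN hp 0 le_rfl (by norm_num))⟩

end

end MuPIR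

theorem corollary2 (N : ℕ) (hN : 2 ≤ N)
    (p : PMF (MuPIR.Demand 2 2)) (hp : ∀ θ, p θ ≠ 0)
    (M : ℝ) (hM0 : 0 ≤ M) (hM2 : M ≤ 2) :
    IsGLB (MuPIR.achievableUncodedLoads 2 2 N p M) (MuPIR.optimalUncodedLoad 2 2 N p M) ∧
    (M ≤ 2 * ((N : ℝ) - 1) / (2 * (N : ℝ) - 1) →
      MuPIR.optimalUncodedLoad 2 2 N p M = 2 - 3 / 2 * M) ∧
    (2 * ((N : ℝ) - 1) / (2 * (N : ℝ) - 1) ≤ M →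
      MuPIR.optimalUncodedLoad 2 2 N p M = ((N : ℝ) + 1) * (2 - M) / (2 * (N : ℝ))) ∧
    ((∃ r : ℚ, (r : ℝ) = M) →
      MuPIR.optimalUncodedLoad 2 2 N p M ∈ MuPIR.achievableUncodedLoads 2 2 N p M) := by
  have hN' : (2 : ℝ) ≤ N := by exact_mod_cast hN
  have hpos : (0 : ℝ) < 2 * N - 1 := by linarith
  rw [MuPIR.optimalUncodedLoad_eq hN hp hM0 hM2]
  refine ⟨MuPIR.isGLB_optimalLoad hN hp hM0 hM2, fun h => ?_, fun h => ?_, ?_⟩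
  · exact MuPIR.optimalLoad_eq_low (by omega) ((le_div_iff₀ hpos).1 h)
  · exact MuPIR.optimalLoad_eq_high (by omega) ((div_le_iff₀ hpos).1 h)
  · rintro ⟨r, rfl⟩
    exact MuPIR.optimalLoad_mem_of_rat hN hp r (by exact_mod_cast hM0) (by exact_mod_cast hM2)
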